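/- Fix parameters $\gamma\in(2,3)$, $\delta\in\mathbb N=\{1,2,\dots\}$, $\zeta\in(0,\frac1{\gamma-1}]$, $\beta\in(1,2)$, $s\in\mathbb N$ with $s>\delta$, $\tau\in(\zeta,1)$ and $\xi\in(0,1)$. For integers $1\le a\le b$, let $\mathrm{TPL}(\gamma,a,b)$ be the truncated power law on $\{a,\dots,b\}$ with $P(X=k)=\int_k^{k+1}x^{-\gamma}dx\big/\int_a^{b+1}x^{-\gamma}dx$, and let $\mu(\gamma,a,b)$ be its mean; a real upper end point $b$ is replaced by $\lfloor b\rfloor$. For $n\in\mathbb N$, the degrees and the communities of an ABCD graph $G_n$ on $n$ nodes are generated as follows. (1) *Degrees.* Take $n$ independent samples of $\mathrm{TPL}(\gamma,\delta,n^\zeta)$; decrease the largest one by $1$ if the sum is odd; sort them as $d_1\ge\dots\ge d_n$. (2) *Communities.* Independently of (1), draw independent sizes from $\mathrm{TPL}(\beta,s,n^\tau)$ until their sum is at least $n$, say $n+k$. If the last size $c$ satisfies $c\ge k+s$, replace it by $c-k$; otherwise delete it, select $c-k$ distinct old communities and increase their sizes by $1$ (the selection may be made by any fixed, deterministic or randomized,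 rule). Let $\mathbf C_n=(C_1,\dots,C_L)$, with $|C_1|\ge\dots\ge|C_L|$, be the resulting communities, so that $\sum_j|C_j|=n$, and let $\phi=1-\frac1{n^2}\sum_{j\le L}|C_j|^2$. (3) *Assignment.* For $i=1,\dots,n$ in turn, give degree $d_i$ to a node chosen uniformly at random among the nodes $u$ that have no degree yet and satisfy $d_i\le\frac{|C(u)|-1}{1-\xi\phi}$, where $C(u)$ is the community of $u$. (If there is no such node, choose among all nodes without a degree.) The edges of $G_n$, created afterwards, realize these degrees. Let $\mathrm{vol}(C_j)$ be the sum of the degrees of the nodes of $C_j$, let $\mathbb E[\,\cdot\mid\mathbf C_n]$ be the conditional expectation given the community sizes, and for a community of size $z$ let $\Delta_z=\min\{\frac{z-1}{1-\xi\phi},n^\zeta\}$. "W.h.p." means with probability tending to $1$ as $n\to\infty$. Then the following hold. (a) There is a deterministic sequence $\varepsilon_n\to0$ such that w.h.p., simultaneously for all communities $C_j$, with $z=|C_j|$, $$\Big|\frac{\mathbb E[\mathrm{vol}(C_j)\mid\mathbf C_n]}{z}-\mu(\gamma,\delta,\Delta_z)\Big|\le\varepsilon_n\,\mu(\gamma,\delta,\Delta_z).$$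 (b) For every deterministic sequence $z(n)\to\infty$ there is a deterministic sequence $\varepsilon_n\to0$ such that w.h.p., simultaneously for all communities $C_j$ with $|C_j|\ge z(n)$, $$\Big|\frac{\mathbb E[\mathrm{vol}(C_j)\mid\mathbf C_n]}{|C_j|}-\mu(\gamma,\delta,n^\zeta)\Big|\le\varepsilon_n\,\mu(\gamma,\delta,n^\zeta).$$ (c) There are constants $a,b>0$, depending only on the parameters and the selection rule, such that w.h.p., simultaneously for all communities $C_j$, $$a\,\mu(\gamma,\delta,n^\zeta)\le\frac{\mathbb E[\mathrm{vol}(C_j)\mid\mathbf C_n]}{|C_j|}\le b\,\mu(\gamma,\delta,n^\zeta).$$ -/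

import Mathlib

open Filter Topology MeasureTheory

noncomputable section

/-- The parameters of the ABCD model other than the number `n` of nodes, with their ranges. -/
structure ABCDParams where
  γ : ℝ
  δ : ℕ
  ζ : ℝ
  β : ℝ
  s : ℕ
  τ : ℝ
  ξ : ℝ
  two_lt_γ : 2 < γ
  γ_lt_three : γ < 3
  one_le_δ : 1 ≤ δ
  ζ_pos : 0 < ζ
  ζ_le : ζ ≤ 1 / (γ - 1)
  one_lt_β : 1 < β
  β_lt_two : β < 2
  δ_lt_s : δ < s
  ζ_lt_τ : ζ < τ
  τ_lt_one : τ < 1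
  ξ_pos : 0 < ξ
  ξ_lt_one : ξ < 1

/-! ### Truncated power laws -/

/-- The probability that a truncated power law with exponent `γ` on `{δ, …, Δ}` gives to `k`. -/
def tplProb (γ : ℝ) (δ Δ k : ℕ) : ℝ :=
  (∫ x in (k : ℝ)..((k : ℝ) + 1), x ^ (-γ)) / ∫ x in (δ : ℝ)..((Δ : ℝ) + 1), x ^ (-γ)

theorem intervalIntegrable_rpow_neg_of_pos (γ : ℝ) {a b : ℝ} (ha : 0 < a) (hb : 0 < b) :
    IntervalIntegrable (fun x : ℝ => x ^ (-γ)) volume a b := by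
  apply intervalIntegral.intervalIntegrable_rpow
  right
  intro h
  have := (Set.mem_uIcc.1 h)
  rcases this with h | h <;> linarith [h.1, h.2]

theorem tplProb_nonneg (γ : ℝ) (δ Δ k : ℕ) (h : δ ≤ Δ) : 0 ≤ tplProb γ δ Δ k := by
  have hΔ : (δ : ℝ) ≤ Δ := by exact_mod_cast h
  apply div_nonneg
  · apply intervalIntegral.integral_nonneg (by linarith)
    intro u hu
    exact Real.rpow_nonneg ((Nat.cast_nonneg k).trans hu.1) _
  · apply intervalIntegral.integral_nonneg (by linarith)
    intro u hu
    exact Real.rpow_nonneg ((Nat.cast_nonneg δ).trans hu.1) _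

theorem sum_tplProb (γ : ℝ) (δ Δ : ℕ) (h0 : 1 ≤ δ) (h : δ ≤ Δ) :
    ∑ k ∈ Finset.Icc δ Δ, tplProb γ δ Δ k = 1 := by
  have hδ : (0 : ℝ) < δ := by exact_mod_cast h0
  have hΔ : (δ : ℝ) ≤ Δ := by exact_mod_cast h
  have hpos : 0 < ∫ x in (δ : ℝ)..((Δ : ℝ) + 1), x ^ (-γ) := by
    apply intervalIntegral.intervalIntegral_pos_of_pos_on
    · exact intervalIntegrable_rpow_neg_of_pos γ hδ (by linarith)
    · intro x hx
      exact Real.rpow_pos_of_pos (hδ.trans hx.1) _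
    · linarith
  unfold tplProb
  rw [← Finset.sum_div, div_eq_one_iff_eq hpos.ne']
  have key := intervalIntegral.sum_integral_adjacent_intervals_Ico
    (f := fun x : ℝ => x ^ (-γ)) (μ := volume) (a := fun k : ℕ => (k : ℝ))
    (m := δ) (n := Δ + 1) (by omega) (by
      intro k hk
      have hk1 : 1 ≤ k := h0.trans hk.1
      have : (0 : ℝ) < k := by exact_mod_cast hk1
      exact intervalIntegrable_rpow_neg_of_pos γ this (by push_cast; linarith))
  have hI : Finset.Icc δ Δ = Finset.Ico δ (Δ + 1) := by
    ext k; simp [Finset.mem_Icc, Finset.mem_Ico]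
  rw [hI]
  push_cast at key
  exact key

/-- The truncated power-law distribution with exponent `γ` on `{δ, …, Δ}`, for `1 ≤ δ ≤ Δ`
(a point mass at `δ` for other values, which play no role). -/
def tpl (γ : ℝ) (δ Δ : ℕ) : PMF ℕ :=
  if h : 1 ≤ δ ∧ δ ≤ Δ then
    PMF.ofFinset
      (fun k => if k ∈ Finset.Icc δ Δ then ENNReal.ofReal (tplProb γ δ Δ k) else 0)
      (Finset.Icc δ Δ)
      (by
        rw [Finset.sum_congr rfl (fun k hk => if_pos hk),
          ← ENNReal.ofReal_sum_of_nonneg (fun k _ => tplProb_nonneg γ δ Δ k h.2),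
          sum_tplProb γ δ Δ h.1 h.2, ENNReal.ofReal_one])
      (fun k hk => if_neg hk)
  else PMF.pure δ

/-- The mean of the truncated power law with exponent `γ` on `{δ, …, Δ}`. -/
def tplMean (γ : ℝ) (δ Δ : ℕ) : ℝ := ∫ k, (k : ℝ) ∂(tpl γ δ Δ).toMeasure

/-- The law of a list of `m` independent samples from `p`. -/
def iidList (p : PMF ℕ) : ℕ → PMF (List ℕ)
  | 0 => PMF.pure []
  | m + 1 => p.bind fun a => (iidList p m).map fun l => a :: l

/-- Non-increasing rearrangement. -/
def sortDesc (l : List ℕ) : List ℕ := l.insertionSort (· ≥ ·)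

/-! ### Phase 1: the degree sequence -/

/-- Decrease the first entry by one if the sum is odd. -/
def fixParity (d : List ℕ) : List ℕ :=
  if Even d.sum then d else
    match d with
    | [] => []
    | a :: t => (a - 1) :: t

/-- The law of the non-increasing degree sequence: `n` independent samples from the truncated power
law on `{δ, …, ⌊n ^ ζ⌋}`, the largest one being decreased by one if the sum is odd. -/
def degreeLaw (P : ABCDParams) (n : ℕ) : PMF (List ℕ) :=
  (iidList (tpl P.γ P.δ ⌊(n : ℝ) ^ P.ζ⌋₊) n).map fun l => sortDesc (fixParity (sortDesc l))

/-! ### Phase 2: the community sizes -/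

/-- `sel r l` is the law of the set of positions of the `r` members of the list `l` of old
communities that are enlarged by one node; any (random or deterministic) way to select `r` distinct
old communities is allowed. -/
def IsSelectionRule (sel : ℕ → List ℕ → PMF (Finset ℕ)) : Prop :=
  ∀ (r : ℕ) (l : List ℕ), r ≤ l.length →
    ∀ I ∈ (sel r l).support, I ⊆ Finset.range l.length ∧ I.card = r

/-- Increase by one the entries whose positions belong to `I`. -/
def enlarge (I : Finset ℕ) (l : List ℕ) : List ℕ :=
  l.mapIdx fun i c => if i ∈ I then c + 1 else c

/-- Draw independent community sizes from `p`, after the sizes `old` with sum less than `n`, until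
the sum is at least `n`, say `n + k`. If the last size `c` is at least `k + s`, it is reduced by `k`;
otherwise it is deleted and `c - k` old communities are enlarged by one, so that the sum becomes `n`.
The first argument bounds the number of draws. -/
def drawSizes (p : PMF ℕ) (sel : ℕ → List ℕ → PMF (Finset ℕ)) (s n : ℕ) :
    ℕ → List ℕ → PMF (List ℕ)
  | 0, old => PMF.pure old
  | fuel + 1, old => p.bind fun c =>
      if old.sum + c < n then drawSizes p sel s n fuel (old ++ [c])
      else
        let k := old.sum + c - n
        if k + s ≤ c then PMF.pure (old ++ [c - k])
        else (sel (c - k) old).map fun I => enlarge I old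

/-- The law of the non-increasing sequence of community sizes. All sizes that are drawn are at least
`s ≥ 1`, so at most `n` draws are made. -/
def communityLaw (P : ABCDParams) (sel : ℕ → List ℕ → PMF (Finset ℕ)) (n : ℕ) :
    PMF (List ℕ) :=
  (drawSizes (tpl P.β P.s ⌊(n : ℝ) ^ P.τ⌋₊) sel P.s n n []).map sortDesc

/-! ### Phase 3: assigning the degrees to the nodes -/

/-- The nodes of a graph with community sizes `c`: the members of the community number `j` are the
pairs `⟨j, i⟩`. -/
abbrev Node (c : List ℕ) : Type := Σ j : Fin c.length, Fin (c.get j)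

/-- `φ = 1 - n⁻² ∑ |C_j|²`. -/
def phi (n : ℕ) (c : List ℕ) : ℝ :=
  1 - (1 / (n : ℝ) ^ 2) * (c.map fun z => (z : ℝ) ^ 2).sum

/-- The bound `(z - 1) / (1 - ξ φ)` for the degrees in a community of size `z`. -/
def degreeCap (P : ABCDParams) (n : ℕ) (c : List ℕ) (z : ℕ) : ℝ :=
  ((z : ℝ) - 1) / (1 - P.ξ * phi n c)

open Classical in
/-- Assign the degrees of the given list one after the other, each to a uniformly random node among
the nodes `u ∈ U` that are still unassigned and admit this degree (`a ≤ cap u`); `f` records the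
degrees assigned so far. If no unassigned node admits the degree, in which case the construction is
not defined, we choose from all the unassigned nodes. -/
def assignDegrees {V : Type} (cap : V → ℝ) :
    List ℕ → Finset V → (V → ℕ) → PMF (V → ℕ)
  | [], _, f => PMF.pure f
  | a :: t, U, f =>
      if h : (U.filter fun u => (a : ℝ) ≤ cap u).Nonempty then
        (PMF.uniformOfFinset (U.filter fun u => (a : ℝ) ≤ cap u) h).bind fun u =>
          assignDegrees cap t (U.erase u) (Function.update f u a)
      else if h' : U.Nonempty then
        (PMF.uniformOfFinset U h').bind fun u =>
          assignDegrees cap t (U.erase u) (Function.update f u a)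
      else PMF.pure f

/-! ### The model -/

/-- The community sizes and the degrees of the nodes of an ABCD graph. -/
structure ABCDOutcome where
  sizes : List ℕ
  deg : Node sizes → ℕ

instance : MeasurableSpace ABCDOutcome := ⊤

/-- The joint law of the communities and of the degrees of the nodes in an ABCD graph with `n`
nodes. The edges that are created afterwards realize these degrees. -/
def abcd (P : ABCDParams) (sel : ℕ → List ℕ → PMF (Finset ℕ)) (n : ℕ) : PMF ABCDOutcome :=
  (degreeLaw P n).bind fun d =>
    (communityLaw P sel n).bind fun c =>
      (assignDegrees (fun u : Node c => degreeCap P n c (c.get u.1)) d Finset.univ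
        (fun _ => 0)).map fun f => ⟨c, f⟩

/-- The volume of the community number `j`: the sum of the degrees of its nodes. -/
def vol (j : ℕ) (ω : ABCDOutcome) : ℕ :=
  if h : j < ω.sizes.length then ∑ i : Fin (ω.sizes.get ⟨j, h⟩), ω.deg ⟨⟨j, h⟩, i⟩ else 0

/-- The expected volume of the community number `j`, conditionally on the sizes of the communities
being `c`. -/
def expVol (P : ABCDParams) (sel : ℕ → List ℕ → PMF (Finset ℕ)) (n : ℕ) (c : List ℕ) (j : ℕ) : ℝ :=
  ∫ ω, (vol j ω : ℝ) ∂(ProbabilityTheory.cond (abcd P sel n).toMeasure {ω | ω.sizes = c})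

/-- The expected volume of the community number `j` given the community sizes `c`, divided by the
size of this community. -/
def expAvgDegree (P : ABCDParams) (sel : ℕ → List ℕ → PMF (Finset ℕ)) (n : ℕ) (c : List ℕ)
    (j : Fin c.length) : ℝ :=
  expVol P sel n c j / (c.get j : ℝ)

/-- The integer part of `Δ_z = min {(z - 1) / (1 - ξ φ), n ^ ζ}`. -/
def maxDegree (P : ABCDParams) (n : ℕ) (c : List ℕ) (z : ℕ) : ℕ :=
  ⌊min (degreeCap P n c z) ((n : ℝ) ^ P.ζ)⌋₊

/-- The sequence of events `E` about the community sizes holds with high probability. -/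
def Whp (P : ABCDParams) (sel : ℕ → List ℕ → PMF (Finset ℕ)) (E : ℕ → List ℕ → Prop) : Prop :=
  Tendsto (fun n => (abcd P sel n).toMeasure {ω | E n ω.sizes}) atTop (𝓝 1)

end

/-!
Write `M = ⌊n ^ ζ⌋`, let `z` be the size of the community of a node `u`, and let `m = maxDegree`, so
that `u` admits exactly the degrees up to `m`.

*One node, fixed degrees.* The degrees are assigned in decreasing order. If every node admitted every
degree, each of the degrees `b ≤ m` would be given to `u` with the same probability. In fact, at most
`g` nodes, those in communities of size at most `M + 1`, refuse some degree. When `r` degrees are left,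
exactly `r` nodes are free, and between `r - g` and `r` of them admit the next degree. If at least `q`
degrees equal `δ`, then `r ≥ q` as long as the next degree exceeds `δ`, so each of these probabilities
changes by a factor between `(q - g) / q` and `q / (q - g)`. The degree `δ` itself needs no care
because, unless all samples are minimal, all degrees are at least `δ`: it suffices to estimate the
expected excess over `δ` (`pmfExp_assignDegrees_le`, `le_pmfExp_assignDegrees`).

*Random degrees.* Given how many of the samples are at most `m`, these are independent with the law
truncated at `m`. Hence the expected average of the samples that are at most `m` is the mean
`μ(γ, δ, m)`, with no error (`pmfExp_iidList_excessSum_mul`, `pmfExp_tpl_excess`). The parity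
correction costs `O(M / q)`. The number of samples equal to `δ` is at least a constant times `n` except
with exponentially small probability (`exists_atypicalProb_tpl_le`), and all degrees are at most
`M = o(n)`, so the exceptional event is negligible in expectation.

*Communities.* It remains to see that `g = o(n)` with high probability. A supermartingale along the
successive draws bounds `𝔼[g]` by `O(n)` times the size-biased probability that a community is small
(`pmfExp_drawSizes_le`); the latter is of order `n ^ (-(τ - ζ) (2 - β))`, and Markov's inequality
concludes (`exists_tendsto_pmfExp_typicalSizes`).

This proves the first claim. As `γ > 2`, the means `μ(γ, δ, m)` increase to a finite limit
(`tplMean_mono`, `exists_tendsto_tplMean`), and the other two claims follow.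
-/

open scoped ENNReal

/-! ### Expectations under probability mass functions -/

/-- The expectation of a function with values in `[0, ∞]` under a probability mass function. -/
noncomputable def pmfExp {α : Type*} (p : PMF α) (f : α → ℝ≥0∞) : ℝ≥0∞ := ∑' a, p a * f a

section pmfExp

variable {α β : Type*}

theorem pmfExp_pure (a : α) (f : α → ℝ≥0∞) : pmfExp (PMF.pure a) f = f a := by
  classical
  unfold pmfExp
  rw [tsum_eq_single a]
  · simp
  · intro b hb
    simp [PMF.pure_apply, hb]

theorem pmfExp_bind (p : PMF α) (q : α → PMF β) (f : β → ℝ≥0∞) :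
    pmfExp (p.bind q) f = pmfExp p fun a => pmfExp (q a) f := by
  unfold pmfExp
  simp_rw [PMF.bind_apply, ← ENNReal.tsum_mul_right, ← ENNReal.tsum_mul_left]
  rw [ENNReal.tsum_comm]
  simp_rw [mul_assoc]

theorem pmfExp_map (p : PMF α) (g : α → β) (f : β → ℝ≥0∞) :
    pmfExp (p.map g) f = pmfExp p fun a => f (g a) := by
  rw [← PMF.bind_pure_comp, pmfExp_bind]
  simp [pmfExp_pure]

theorem pmfExp_mono (p : PMF α) {f g : α → ℝ≥0∞} (h : ∀ a ∈ p.support, f a ≤ g a) :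
    pmfExp p f ≤ pmfExp p g := by
  refine ENNReal.tsum_le_tsum fun a => ?_
  by_cases ha : p a = 0
  · simp [ha]
  · exact mul_le_mul_right (h a ((PMF.mem_support_iff _ _).2 ha)) _

theorem pmfExp_congr (p : PMF α) {f g : α → ℝ≥0∞} (h : ∀ a ∈ p.support, f a = g a) :
    pmfExp p f = pmfExp p g :=
  le_antisymm (pmfExp_mono p fun a ha => (h a ha).le) (pmfExp_mono p fun a ha => (h a ha).ge)

theorem pmfExp_const (p : PMF α) (c : ℝ≥0∞) : pmfExp p (fun _ => c) = c := by
  unfold pmfExp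
  rw [ENNReal.tsum_mul_right, p.tsum_coe, one_mul]

theorem pmfExp_add (p : PMF α) (f g : α → ℝ≥0∞) :
    pmfExp p (fun a => f a + g a) = pmfExp p f + pmfExp p g := by
  unfold pmfExp
  simp_rw [mul_add]
  exact ENNReal.tsum_add

theorem pmfExp_const_mul (p : PMF α) (c : ℝ≥0∞) (f : α → ℝ≥0∞) :
    pmfExp p (fun a => c * f a) = c * pmfExp p f := by
  unfold pmfExp
  rw [← ENNReal.tsum_mul_left]
  simp_rw [mul_left_comm]

theorem pmfExp_mul_const (p : PMF α) (c : ℝ≥0∞) (f : α → ℝ≥0∞) :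
    pmfExp p (fun a => f a * c) = pmfExp p f * c := by
  simp_rw [mul_comm _ c]
  exact pmfExp_const_mul p c f

theorem pmfExp_finset_sum {ι : Type*} (p : PMF α) (s : Finset ι) (f : ι → α → ℝ≥0∞) :
    pmfExp p (fun a => ∑ i ∈ s, f i a) = ∑ i ∈ s, pmfExp p (f i) := by
  classical
  induction s using Finset.induction_on with
  | empty => simpa using pmfExp_const p 0
  | insert i s hi ih => simp [Finset.sum_insert hi, pmfExp_add, ih]

theorem pmfExp_le_of_forall (p : PMF α) {f : α → ℝ≥0∞} {c : ℝ≥0∞}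
    (h : ∀ a ∈ p.support, f a ≤ c) : pmfExp p f ≤ c :=
  (pmfExp_mono p h).trans (pmfExp_const p c).le

theorem le_pmfExp_of_forall (p : PMF α) {f : α → ℝ≥0∞} {c : ℝ≥0∞}
    (h : ∀ a ∈ p.support, c ≤ f a) : c ≤ pmfExp p f :=
  (pmfExp_const p c).ge.trans (pmfExp_mono p h)

theorem pmfExp_eq_sum (p : PMF α) (f : α → ℝ≥0∞) (s : Finset α) (h : ∀ a ∉ s, p a = 0) :
    pmfExp p f = ∑ a ∈ s, p a * f a :=
  tsum_eq_sum fun a ha => by simp [h a ha]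

theorem lintegral_pmf_toMeasure [MeasurableSpace α] [MeasurableSingletonClass α] (p : PMF α)
    (f : α → ℝ≥0∞) : ∫⁻ a, f a ∂p.toMeasure = pmfExp p f := by
  rw [← p.restrict_toMeasure_support, lintegral_countable _ p.support_countable]
  simp_rw [PMF.toMeasure_apply_singleton _ _ (measurableSet_singleton _)]
  unfold pmfExp
  simp_rw [mul_comm (f _)]
  rw [tsum_subtype p.support fun a => p a * f a]
  refine tsum_congr fun a => ?_
  by_cases ha : a ∈ p.support
  · simp [Set.indicator_of_mem ha]
  · rw [Set.indicator_of_notMem ha]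
    rw [PMF.mem_support_iff, not_not] at ha
    simp [ha]

theorem pmf_toMeasure_eq_pmfExp [MeasurableSpace α] [MeasurableSingletonClass α] (p : PMF α)
    (s : Set α) (hs : MeasurableSet s) : p.toMeasure s = pmfExp p (s.indicator fun _ => 1) := by
  rw [← lintegral_pmf_toMeasure, lintegral_indicator hs]
  simp

/-- An average over a finite set in which one element contributes at most `A` and all the others at
most `B`. -/
theorem pmfExp_uniformOfFinset_le [DecidableEq α] (s : Finset α) (h : s.Nonempty)
    (f : α → ℝ≥0∞) (u : α) (hu : u ∈ s) {A B : ℝ} (hA : 0 ≤ A) (hB : 0 ≤ B)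
    (hfu : f u ≤ ENNReal.ofReal A) (hf : ∀ v ∈ s, v ≠ u → f v ≤ ENNReal.ofReal B) :
    pmfExp (PMF.uniformOfFinset s h) f
      ≤ ENNReal.ofReal ((A + ((s.card : ℝ) - 1) * B) / s.card) := by
  have hc : 0 < s.card := h.card_pos
  have hc1 : (1 : ℝ) ≤ s.card := by exact_mod_cast hc
  have hcp : (s.card : ℝ) - 1 = ((s.card - 1 : ℕ) : ℝ) := (Nat.cast_pred hc).symm
  rw [pmfExp_eq_sum _ _ s fun a ha => PMF.uniformOfFinset_apply_of_notMem _ ha]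
  rw [Finset.sum_congr rfl fun a ha => by rw [PMF.uniformOfFinset_apply_of_mem _ ha],
    ← Finset.mul_sum, ← Finset.add_sum_erase _ _ hu, div_eq_inv_mul,
    ENNReal.ofReal_mul (by positivity),
    ENNReal.ofReal_inv_of_pos (by positivity), ENNReal.ofReal_natCast]
  gcongr
  rw [ENNReal.ofReal_add hA (mul_nonneg (by linarith) hB)]
  gcongr
  calc ∑ x ∈ s.erase u, f x ≤ ∑ x ∈ s.erase u, ENNReal.ofReal B :=
        Finset.sum_le_sum fun v hv => hf v (Finset.mem_of_mem_erase hv) (Finset.ne_of_mem_erase hv)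
    _ = _ := by
        rw [Finset.sum_const, Finset.card_erase_of_mem hu, nsmul_eq_mul,
          ENNReal.ofReal_mul (by linarith), hcp, ENNReal.ofReal_natCast]

/-- An average over a finite set in which one element contributes at least `A` and all the others at
least `B`. -/
theorem le_pmfExp_uniformOfFinset [DecidableEq α] (s : Finset α) (h : s.Nonempty)
    (f : α → ℝ≥0∞) (u : α) (hu : u ∈ s) {A B : ℝ} (hA : 0 ≤ A) (hB : 0 ≤ B)
    (hfu : ENNReal.ofReal A ≤ f u) (hf : ∀ v ∈ s, v ≠ u → ENNReal.ofReal B ≤ f v) :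
    ENNReal.ofReal ((A + ((s.card : ℝ) - 1) * B) / s.card)
      ≤ pmfExp (PMF.uniformOfFinset s h) f := by
  have hc : 0 < s.card := h.card_pos
  have hc1 : (1 : ℝ) ≤ s.card := by exact_mod_cast hc
  have hcp : (s.card : ℝ) - 1 = ((s.card - 1 : ℕ) : ℝ) := (Nat.cast_pred hc).symm
  rw [pmfExp_eq_sum _ _ s fun a ha => PMF.uniformOfFinset_apply_of_notMem _ ha]
  rw [Finset.sum_congr rfl fun a ha => by rw [PMF.uniformOfFinset_apply_of_mem _ ha],
    ← Finset.mul_sum, ← Finset.add_sum_erase _ _ hu, div_eq_inv_mul,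
    ENNReal.ofReal_mul (by positivity),
    ENNReal.ofReal_inv_of_pos (by positivity), ENNReal.ofReal_natCast]
  gcongr
  rw [ENNReal.ofReal_add hA (mul_nonneg (by linarith) hB)]
  gcongr
  calc _ = ∑ x ∈ s.erase u, ENNReal.ofReal B := by
        rw [Finset.sum_const, Finset.card_erase_of_mem hu, nsmul_eq_mul,
          ENNReal.ofReal_mul (by linarith), hcp, ENNReal.ofReal_natCast]
    _ ≤ ∑ x ∈ s.erase u, f x :=
        Finset.sum_le_sum fun v hv => hf v (Finset.mem_of_mem_erase hv) (Finset.ne_of_mem_erase hv)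

end pmfExp

/-! ### The degree of one node -/

/-- The sum of the excesses `b - δ` over the entries `b ≤ m` of a list. -/
def excessSum (δ m : ℕ) (l : List ℕ) : ℕ := ((l.filter (· ≤ m)).map (· - δ)).sum

/-- The number of entries of a list that are at most `m`. -/
def countLE (m : ℕ) (l : List ℕ) : ℕ := l.countP (· ≤ m)

theorem excessSum_nil (δ m : ℕ) : excessSum δ m [] = 0 := rfl

theorem countLE_nil (m : ℕ) : countLE m [] = 0 := rfl

theorem excessSum_cons (δ m a : ℕ) (t : List ℕ) :
    excessSum δ m (a :: t) = (if a ≤ m then a - δ else 0) + excessSum δ m t := by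
  unfold excessSum
  by_cases h : a ≤ m <;> simp [h]

theorem countLE_cons (m a : ℕ) (t : List ℕ) :
    countLE m (a :: t) = (if a ≤ m then 1 else 0) + countLE m t := by
  unfold countLE
  by_cases h : a ≤ m <;> simp [h, add_comm]

theorem countLE_le_length (m : ℕ) (l : List ℕ) : countLE m l ≤ l.length := List.countP_le_length

theorem countLE_eq_length {m : ℕ} {l : List ℕ} (h : ∀ b ∈ l, b ≤ m) : countLE m l = l.length :=
  List.countP_eq_length.2 (by simpa using h)

theorem countLE_mono {m m' : ℕ} (h : m ≤ m') (l : List ℕ) : countLE m l ≤ countLE m' l :=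
  List.countP_mono_left fun b _ hb => by simp at hb ⊢; omega

section assign

variable {V : Type} (cap : V → ℝ)

open Classical in
/-- One step of the assignment: as long as there are free nodes, the degree is given to a uniform
element of a nonempty set of free nodes, which consists of those that admit it if there are any. -/
theorem assignDegrees_cons (a : ℕ) (t : List ℕ) (U : Finset V) (f : V → ℕ) (hU : U.Nonempty) :
    ∃ (s : Finset V) (h : s.Nonempty), s ⊆ U ∧
      ((U.filter fun u => (a : ℝ) ≤ cap u).Nonempty → s = U.filter fun u => (a : ℝ) ≤ cap u) ∧
      assignDegrees cap (a :: t) U f = (PMF.uniformOfFinset s h).bind fun u =>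
        assignDegrees cap t (U.erase u) (Function.update f u a) := by
  by_cases h : (U.filter fun u => (a : ℝ) ≤ cap u).Nonempty
  · exact ⟨_, h, Finset.filter_subset _ _, fun _ => rfl, by rw [assignDegrees, dif_pos h]⟩
  · exact ⟨_, hU, subset_rfl, fun h' => absurd h' h, by rw [assignDegrees, dif_neg h, dif_pos hU]⟩

open Classical in
theorem apply_eq_of_mem_support_assignDegrees (l : List ℕ) :
    ∀ (U : Finset V) (f : V → ℕ), ∀ h ∈ (assignDegrees cap l U f).support, ∀ u ∉ U, h u = f u := by
  induction l with
  | nil =>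
    intro U f h hh u _
    rw [assignDegrees, PMF.support_pure, Set.mem_singleton_iff] at hh
    rw [hh]
  | cons a t ih =>
    intro U f h hh u hu
    by_cases hU : U.Nonempty
    · obtain ⟨s, hs, hsU, -, he⟩ := assignDegrees_cons cap a t U f hU
      rw [he, PMF.mem_support_bind_iff] at hh
      obtain ⟨v, hv, hh⟩ := hh
      rw [PMF.mem_support_uniformOfFinset_iff] at hv
      rw [ih _ _ h hh u fun h' => hu (Finset.mem_of_mem_erase h'),
        Function.update_of_ne (fun e : u = v => hu (e.symm ▸ hsU hv))]
    · rw [Finset.not_nonempty_iff_eq_empty] at hU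
      subst hU
      rw [assignDegrees, dif_neg (by simp), dif_neg (by simp), PMF.support_pure,
        Set.mem_singleton_iff] at hh
      rw [hh]

open Classical in
theorem apply_mem_of_mem_support_assignDegrees (l : List ℕ) :
    ∀ (U : Finset V) (f : V → ℕ), U.card = l.length →
      ∀ h ∈ (assignDegrees cap l U f).support, ∀ u ∈ U, h u ∈ l := by
  induction l with
  | nil =>
    intro U f hc h _ u hu
    rw [List.length_nil, Finset.card_eq_zero] at hc
    simp [hc] at hu
  | cons a t ih =>
    intro U f hc h hh u hu
    obtain ⟨s, hs, hsU, -, he⟩ := assignDegrees_cons cap a t U f ⟨u, hu⟩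
    rw [he, PMF.mem_support_bind_iff] at hh
    obtain ⟨v, hv, hh⟩ := hh
    rw [PMF.mem_support_uniformOfFinset_iff] at hv
    by_cases huv : u = v
    · subst huv
      rw [apply_eq_of_mem_support_assignDegrees cap t _ _ h hh u (Finset.notMem_erase _ _),
        Function.update_self]
      exact List.mem_cons_self
    · refine List.mem_cons_of_mem _ (ih _ _ ?_ h hh u (Finset.mem_erase.2 ⟨huv, hu⟩))
      rw [Finset.card_erase_of_mem (hsU hv), hc]
      simp

open Classical in
theorem card_filter_cap_bounds (U : Finset V) (a g : ℕ)
    (hg : (U.filter fun v => cap v < a).card ≤ g) :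
    U.card ≤ (U.filter fun v => (a : ℝ) ≤ cap v).card + g ∧
      (U.filter fun v => (a : ℝ) ≤ cap v).card ≤ U.card := by
  have := Finset.card_filter_add_card_filter_not (s := U) fun v => (a : ℝ) ≤ cap v
  simp only [not_le] at this
  exact ⟨by omega, Finset.card_filter_le _ _⟩

open Classical in
/-- The upper bound for the expected excess of the degree of a node `u`. If all nodes admitted all
degrees, `u` would receive each of the degrees `b ≤ m` that it admits with the same probability.
There are at most `g` free nodes that do not admit a given degree, and at least `q` nodes are free
as long as a degree above `δ` is assigned; hence these probabilities change by a factor of at most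
`K = q / (q - g)`. -/
theorem pmfExp_assignDegrees_le (u : V) (δ m g q : ℕ) (K : ℝ) (hgq : g < q)
    (hK : (q : ℝ) ≤ K * (q - g)) (l : List ℕ) :
    ∀ (U : Finset V) (f : V → ℕ), l.Pairwise (· ≥ ·) → U.card = l.length → u ∈ U →
      (∀ b ∈ l, (b : ℝ) ≤ cap u ↔ b ≤ m) →
      (∀ b ∈ l, (U.filter fun v => cap v < b).card ≤ g) → q ≤ countLE δ l →
      pmfExp (assignDegrees cap l U f) (fun h => ((h u - δ : ℕ) : ℝ≥0∞))
        ≤ ENNReal.ofReal (K * excessSum δ m l / countLE m l) := by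
  have hgq' : (0 : ℝ) < q - g := by
    have : (g : ℝ) < q := by exact_mod_cast hgq
    linarith
  have hg0 : (0 : ℝ) ≤ g := by positivity
  have hK1 : 1 ≤ K := by
    by_contra h
    nlinarith
  induction l with
  | nil =>
    intro U f _ hc _ _ _ hq
    simp [countLE] at hq
    omega
  | cons a t ih =>
    intro U f hs hc hu hm hg hq
    have hsa : ∀ {b}, b ∈ t → b ≤ a := fun hb => List.rel_of_pairwise_cons hs hb
    have hst := (List.pairwise_cons.1 hs).2
    by_cases haδ : a ≤ δ
    · refine (pmfExp_le_of_forall (c := 0) _ fun h hh => ?_).trans zero_le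
      have := apply_mem_of_mem_support_assignDegrees cap _ U f hc h hh u hu
      have h1 : h u ≤ a := by
        rcases List.mem_cons.1 this with h1 | h1
        · exact h1.le
        · exact hsa h1
      have h2 : h u - δ = 0 := by omega
      simp [h2]
    · obtain ⟨s, hsn, hsU, hseq, he⟩ := assignDegrees_cons cap a t U f ⟨u, hu⟩
      obtain ⟨hc1, hc2⟩ := card_filter_cap_bounds cap U a g (hg a List.mem_cons_self)
      have hqt : q ≤ countLE δ t := by rw [countLE_cons, if_neg haδ] at hq; omega
      have hqt' := hqt.trans (countLE_le_length δ t)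
      have hlen : (a :: t).length = t.length + 1 := by simp
      have hne : (U.filter fun v => (a : ℝ) ≤ cap v).Nonempty := by
        rw [← Finset.card_pos]; omega
      have hs' := hseq hne
      have hrec : ∀ v ∈ s, v ≠ u →
          pmfExp (assignDegrees cap t (U.erase v) (Function.update f v a))
            (fun h => ((h u - δ : ℕ) : ℝ≥0∞))
          ≤ ENNReal.ofReal (K * excessSum δ m t / countLE m t) := by
        intro v hv hvu
        refine ih _ _ hst ?_ (Finset.mem_erase.2 ⟨hvu.symm, hu⟩)
          (fun b hb => hm b (List.mem_cons_of_mem _ hb)) (fun b hb => ?_) hqt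
        · rw [Finset.card_erase_of_mem (hsU hv), hc]; simp
        · exact (Finset.card_le_card (Finset.filter_subset_filter _ (Finset.erase_subset _ _))).trans
            (hg b (List.mem_cons_of_mem _ hb))
      rw [he, pmfExp_bind]
      by_cases ham : a ≤ m
      · have hus : u ∈ s := by
          rw [hs', Finset.mem_filter]
          exact ⟨hu, (hm a List.mem_cons_self).2 ham⟩
        have hfu : pmfExp (assignDegrees cap t (U.erase u) (Function.update f u a))
            (fun h => ((h u - δ : ℕ) : ℝ≥0∞)) ≤ ENNReal.ofReal ((a - δ : ℕ) : ℝ) := by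
          refine pmfExp_le_of_forall _ fun h hh => ?_
          rw [apply_eq_of_mem_support_assignDegrees cap t _ _ h hh u (Finset.notMem_erase _ _),
            Function.update_self, ENNReal.ofReal_natCast]
        refine (pmfExp_uniformOfFinset_le s hsn _ u hus (by positivity) (by positivity) hfu
          hrec).trans (ENNReal.ofReal_le_ofReal ?_)
        have hTt : countLE m t = t.length :=
          countLE_eq_length fun b hb => (hsa hb).trans ham
        rw [excessSum_cons, countLE_cons, if_pos ham, if_pos ham, hTt]
        have e1 : (t.length : ℝ) + 1 ≤ s.card + g := by
          rw [hs']; exact_mod_cast (by omega)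
        have e2 : (s.card : ℝ) ≤ t.length + 1 := by
          rw [hs']; exact_mod_cast (by omega)
        have e3 : (q : ℝ) ≤ t.length := by exact_mod_cast hqt'
        have es : (0 : ℝ) < s.card := by linarith
        have et : (0 : ℝ) < t.length := by linarith
        have eK : (t.length : ℝ) + 1 ≤ K * s.card := by nlinarith
        have hB : (0 : ℝ) ≤ K * excessSum δ m t / t.length := by positivity
        have hA : (0 : ℝ) ≤ ((a - δ : ℕ) : ℝ) := by positivity
        push_cast
        generalize ((a - δ : ℕ) : ℝ) = A at *
        -- `A / e ≤ K A / r` and `(e - 1) / e ≤ (r - 1) / r`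
        calc (A + ((s.card : ℝ) - 1) * (K * excessSum δ m t / t.length)) / s.card
            = A / s.card + (1 - 1 / s.card) * (K * excessSum δ m t / t.length) := by
              field_simp
          _ ≤ K * A / (t.length + 1)
              + (1 - 1 / ((t.length : ℝ) + 1)) * (K * excessSum δ m t / t.length) := by
              gcongr ?_ + (1 - 1 / ?_) * _
              · rw [div_le_div_iff₀ es (by linarith)]
                nlinarith
          _ = K * (A + excessSum δ m t) / (1 + t.length) := by
              field_simp; ring
      · have hus : u ∉ s := by
          rw [hs', Finset.mem_filter]
          exact fun h => ham ((hm a List.mem_cons_self).1 h.2)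
        refine pmfExp_le_of_forall _ fun v hv => ?_
        rw [PMF.mem_support_uniformOfFinset_iff] at hv
        rw [excessSum_cons, countLE_cons, if_neg ham, if_neg ham, zero_add, zero_add]
        exact hrec v hv fun e => hus (e ▸ hv)

open Classical in
/-- The lower bound that matches `pmfExp_assignDegrees_le`. -/
theorem le_pmfExp_assignDegrees (u : V) (δ m g q : ℕ) (κ : ℝ) (hgq : g < q)
    (hκ0 : 0 ≤ κ) (hκ : κ * q ≤ (q : ℝ) - g) (l : List ℕ) :
    ∀ (U : Finset V) (f : V → ℕ), l.Pairwise (· ≥ ·) → U.card = l.length → u ∈ U →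
      (∀ b ∈ l, (b : ℝ) ≤ cap u ↔ b ≤ m) →
      (∀ b ∈ l, (U.filter fun v => cap v < b).card ≤ g) → q ≤ countLE δ l →
      ENNReal.ofReal (κ * excessSum δ m l / ((countLE m l : ℝ) - g))
        ≤ pmfExp (assignDegrees cap l U f) (fun h => ((h u - δ : ℕ) : ℝ≥0∞)) := by
  have hgq' : (0 : ℝ) < q - g := by
    have : (g : ℝ) < q := by exact_mod_cast hgq
    linarith
  have hg0 : (0 : ℝ) ≤ g := by positivity
  have hκ1 : κ ≤ 1 := by
    by_contra h
    nlinarith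
  induction l with
  | nil =>
    intro U f _ hc _ _ _ hq
    simp [countLE] at hq
    omega
  | cons a t ih =>
    intro U f hs hc hu hm hg hq
    have hsa : ∀ {b}, b ∈ t → b ≤ a := fun hb => List.rel_of_pairwise_cons hs hb
    have hst := (List.pairwise_cons.1 hs).2
    by_cases haδ : a ≤ δ
    · have hz : excessSum δ m (a :: t) = 0 := by
        unfold excessSum
        rw [List.sum_eq_zero_iff]
        intro x hx
        obtain ⟨b, hb, rfl⟩ := List.mem_map.1 hx
        have hb' := (List.mem_filter.1 hb).1
        rcases List.mem_cons.1 hb' with h1 | h1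
        · omega
        · have : b ≤ a := hsa h1
          omega
      simp [hz]
    · obtain ⟨s, hsn, hsU, hseq, he⟩ := assignDegrees_cons cap a t U f ⟨u, hu⟩
      obtain ⟨hc1, hc2⟩ := card_filter_cap_bounds cap U a g (hg a List.mem_cons_self)
      have hqt : q ≤ countLE δ t := by rw [countLE_cons, if_neg haδ] at hq; omega
      have hqt' := hqt.trans (countLE_le_length δ t)
      have hlen : (a :: t).length = t.length + 1 := by simp
      have hne : (U.filter fun v => (a : ℝ) ≤ cap v).Nonempty := by
        rw [← Finset.card_pos]; omega
      have hs' := hseq hne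
      have hrec : ∀ v ∈ s, v ≠ u →
          ENNReal.ofReal (κ * excessSum δ m t / ((countLE m t : ℝ) - g)) ≤
          pmfExp (assignDegrees cap t (U.erase v) (Function.update f v a))
            (fun h => ((h u - δ : ℕ) : ℝ≥0∞)) := by
        intro v hv hvu
        refine ih _ _ hst ?_ (Finset.mem_erase.2 ⟨hvu.symm, hu⟩)
          (fun b hb => hm b (List.mem_cons_of_mem _ hb)) (fun b hb => ?_) hqt
        · rw [Finset.card_erase_of_mem (hsU hv), hc]; simp
        · exact (Finset.card_le_card (Finset.filter_subset_filter _ (Finset.erase_subset _ _))).trans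
            (hg b (List.mem_cons_of_mem _ hb))
      rw [he, pmfExp_bind]
      by_cases ham : a ≤ m
      · have hus : u ∈ s := by
          rw [hs', Finset.mem_filter]
          exact ⟨hu, (hm a List.mem_cons_self).2 ham⟩
        have hfu : ENNReal.ofReal ((a - δ : ℕ) : ℝ) ≤
            pmfExp (assignDegrees cap t (U.erase u) (Function.update f u a))
            (fun h => ((h u - δ : ℕ) : ℝ≥0∞)) := by
          refine le_pmfExp_of_forall _ fun h hh => ?_
          rw [apply_eq_of_mem_support_assignDegrees cap t _ _ h hh u (Finset.notMem_erase _ _),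
            Function.update_self, ENNReal.ofReal_natCast]
        have hTt : countLE m t = t.length :=
          countLE_eq_length fun b hb => (hsa hb).trans ham
        have e1 : (t.length : ℝ) + 1 ≤ s.card + g := by
          rw [hs']; exact_mod_cast (by omega)
        have e2 : (s.card : ℝ) ≤ t.length + 1 := by
          rw [hs']; exact_mod_cast (by omega)
        have e3 : (q : ℝ) ≤ t.length := by exact_mod_cast hqt'
        have es : (0 : ℝ) < s.card := by linarith
        have et : (0 : ℝ) < (t.length : ℝ) - g := by linarith
        have hB : (0 : ℝ) ≤ κ * excessSum δ m t / ((countLE m t : ℝ) - g) := by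
          rw [hTt]; positivity
        refine le_trans (ENNReal.ofReal_le_ofReal ?_)
          (le_pmfExp_uniformOfFinset s hsn _ u hus (by positivity) hB hfu hrec)
        rw [excessSum_cons, countLE_cons, if_pos ham, if_pos ham]
        rw [hTt] at hB ⊢
        have hA : (0 : ℝ) ≤ ((a - δ : ℕ) : ℝ) := by positivity
        push_cast
        generalize ((a - δ : ℕ) : ℝ) = A at *
        have eκ : κ * s.card ≤ 1 + t.length - g := by
          have : κ * (t.length + 1 - q) ≤ t.length + 1 - q := by nlinarith
          nlinarith
        -- `κ A / (r - g) ≤ A / e` and `(r - g - 1) / (r - g) ≤ (e - 1) / e`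
        calc κ * (A + excessSum δ m t) / (1 + (t.length : ℝ) - g)
            = κ * A / (1 + t.length - g)
              + (1 - 1 / (1 + (t.length : ℝ) - g))
                * (κ * excessSum δ m t / ((t.length : ℝ) - g)) := by
              have : (1 : ℝ) + t.length - g ≠ 0 := by linarith
              field_simp; ring
          _ ≤ A / s.card + (1 - 1 / s.card)
                * (κ * excessSum δ m t / ((t.length : ℝ) - g)) := by
              gcongr ?_ + (1 - 1 / ?_) * _
              · rw [div_le_div_iff₀ (by linarith) es]
                nlinarith
              · linarith
              · linarith
          _ = (A + ((s.card : ℝ) - 1) * (κ * excessSum δ m t / ((t.length : ℝ) - g))) / s.card := by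
              field_simp
      · have hus : u ∉ s := by
          rw [hs', Finset.mem_filter]
          exact fun h => ham ((hm a List.mem_cons_self).1 h.2)
        refine le_pmfExp_of_forall _ fun v hv => ?_
        rw [PMF.mem_support_uniformOfFinset_iff] at hv
        rw [excessSum_cons, countLE_cons, if_neg ham, if_neg ham, zero_add, zero_add]
        exact hrec v hv fun e => hus (e ▸ hv)

end assign

/-! ### Independent samples -/

theorem of_mem_support_iidList (p : PMF ℕ) (n : ℕ) :
    ∀ l ∈ (iidList p n).support, l.length = n ∧ ∀ b ∈ l, b ∈ p.support := by
  induction n with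
  | zero =>
    intro l hl
    rw [iidList, PMF.support_pure, Set.mem_singleton_iff] at hl
    simp [hl]
  | succ n ih =>
    intro l hl
    rw [iidList, PMF.mem_support_bind_iff] at hl
    obtain ⟨a, ha, hl⟩ := hl
    rw [PMF.mem_support_map_iff] at hl
    obtain ⟨t, ht, rfl⟩ := hl
    obtain ⟨h1, h2⟩ := ih t ht
    refine ⟨by simp [h1], fun b hb => ?_⟩
    rcases List.mem_cons.1 hb with rfl | hb
    · exact ha
    · exact h2 b hb

theorem pmfExp_iidList_succ (p : PMF ℕ) (n : ℕ) (F : List ℕ → ℝ≥0∞) :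
    pmfExp (iidList p (n + 1)) F = pmfExp p fun a => pmfExp (iidList p n) fun l => F (a :: l) := by
  rw [iidList, pmfExp_bind]
  simp_rw [pmfExp_map]

theorem pmfExp_iidList_prod (p : PMF ℕ) (h : ℕ → ℝ≥0∞) (n : ℕ) :
    pmfExp (iidList p n) (fun l => (l.map h).prod) = pmfExp p h ^ n := by
  induction n with
  | zero => simp [iidList, pmfExp_pure]
  | succ n ih =>
    rw [pmfExp_iidList_succ]
    simp_rw [List.map_cons, List.prod_cons, pmfExp_const_mul, ih, pmfExp_mul_const]
    rw [pow_succ, mul_comm]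

/-- Given the number of samples that are at most `m`, these samples are independent with the law of
a single sample conditioned to be at most `m`, whose mean excess is `ν`. -/
theorem pmfExp_iidList_excessSum_mul (p : PMF ℕ) (δ m : ℕ) (ν : ℝ≥0∞)
    (hν : pmfExp p (fun a => if a ≤ m then ((a - δ : ℕ) : ℝ≥0∞) else 0)
      = ν * pmfExp p (fun a => if a ≤ m then 1 else 0)) (n : ℕ) :
    ∀ h : ℕ → ℝ≥0∞, pmfExp (iidList p n) (fun l => excessSum δ m l * h (countLE m l))
      = ν * pmfExp (iidList p n) (fun l => countLE m l * h (countLE m l)) := by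
  induction n with
  | zero => intro h; simp [iidList, pmfExp_pure, excessSum_nil, countLE_nil]
  | succ n ih =>
    intro h
    rw [pmfExp_iidList_succ, pmfExp_iidList_succ]
    have e1 : ∀ a, pmfExp (iidList p n)
          (fun l => (excessSum δ m (a :: l) : ℝ≥0∞) * h (countLE m (a :: l)))
        = (if a ≤ m then ((a - δ : ℕ) : ℝ≥0∞) else 0)
            * pmfExp (iidList p n) (fun l => h (1 + countLE m l))
          + ν * ((if a ≤ m then 1 else 0)
              * pmfExp (iidList p n) (fun l => countLE m l * h (1 + countLE m l))
            + (if a ≤ m then 0 else 1)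
              * pmfExp (iidList p n) (fun l => countLE m l * h (countLE m l))) := by
      intro a
      by_cases ha : a ≤ m
      · simp only [excessSum_cons, countLE_cons, ha, if_true, Nat.cast_add, add_mul, one_mul,
          zero_mul, add_zero]
        rw [pmfExp_add, pmfExp_const_mul, ← ih fun k => h (1 + k)]
      · simp only [excessSum_cons, countLE_cons, ha, if_false, one_mul, zero_mul, zero_add]
        rw [← ih h]
    have e2 : ∀ a, pmfExp (iidList p n)
          (fun l => (countLE m (a :: l) : ℝ≥0∞) * h (countLE m (a :: l)))
        = (if a ≤ m then 1 else 0)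
            * pmfExp (iidList p n) (fun l => h (1 + countLE m l))
          + ((if a ≤ m then 1 else 0)
              * pmfExp (iidList p n) (fun l => countLE m l * h (1 + countLE m l))
            + (if a ≤ m then 0 else 1)
              * pmfExp (iidList p n) (fun l => countLE m l * h (countLE m l))) := by
      intro a
      by_cases ha : a ≤ m
      · simp only [countLE_cons, ha, if_true, Nat.cast_add, Nat.cast_one, add_mul, one_mul,
          zero_mul, add_zero]
        rw [pmfExp_add]
      · simp only [countLE_cons, ha, if_false, one_mul, zero_mul, zero_add]
    simp_rw [e1, e2]
    rw [pmfExp_add, pmfExp_add, pmfExp_mul_const, pmfExp_mul_const, pmfExp_const_mul, hν, mul_add,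
      mul_assoc]

/-! ### The parity correction and sorting -/

theorem excessSum_perm {δ m : ℕ} {l l' : List ℕ} (h : l.Perm l') :
    excessSum δ m l = excessSum δ m l' :=
  ((h.filter _).map _).sum_eq

theorem countLE_perm {m : ℕ} {l l' : List ℕ} (h : l.Perm l') : countLE m l = countLE m l' :=
  h.countP_eq _

theorem sortDesc_perm (l : List ℕ) : (sortDesc l).Perm l := List.perm_insertionSort _ _

theorem sortDesc_pairwise (l : List ℕ) : (sortDesc l).Pairwise (· ≥ ·) :=
  List.pairwise_insertionSort _ _

theorem fixParity_eq (l : List ℕ) :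
    fixParity l = l ∨ ∃ a t, l = a :: t ∧ fixParity l = (a - 1) :: t := by
  unfold fixParity
  split_ifs with h
  · exact Or.inl rfl
  · cases l with
    | nil => exact Or.inl rfl
    | cons a t => exact Or.inr ⟨a, t, rfl, rfl⟩

theorem length_fixParity (l : List ℕ) : (fixParity l).length = l.length := by
  rcases fixParity_eq l with h | ⟨a, t, rfl, h⟩ <;> simp [h]

theorem excessSum_fixParity_le (δ m : ℕ) (l : List ℕ) :
    excessSum δ m (fixParity l) ≤ excessSum δ m l + m := by
  rcases fixParity_eq l with h | ⟨a, t, rfl, h⟩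
  · rw [h]; omega
  · rw [h, excessSum_cons, excessSum_cons]
    split_ifs <;> omega

theorem le_excessSum_fixParity (δ m : ℕ) (l : List ℕ) :
    excessSum δ m l ≤ excessSum δ m (fixParity l) + 1 := by
  rcases fixParity_eq l with h | ⟨a, t, rfl, h⟩
  · rw [h]; omega
  · rw [h, excessSum_cons, excessSum_cons]
    split_ifs <;> omega

theorem countLE_fixParity_le (m : ℕ) (l : List ℕ) :
    countLE m (fixParity l) ≤ countLE m l + 1 := by
  rcases fixParity_eq l with h | ⟨a, t, rfl, h⟩
  · rw [h]; omega
  · rw [h, countLE_cons, countLE_cons]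
    split_ifs <;> omega

theorem le_countLE_fixParity (m : ℕ) (l : List ℕ) :
    countLE m l ≤ countLE m (fixParity l) := by
  rcases fixParity_eq l with h | ⟨a, t, rfl, h⟩
  · rw [h]
  · rw [h, countLE_cons, countLE_cons]
    split_ifs <;> omega

theorem le_of_mem_fixParity {M : ℕ} {l : List ℕ} (hl : ∀ b ∈ l, b ≤ M) :
    ∀ b ∈ fixParity l, b ≤ M := by
  rcases fixParity_eq l with h | ⟨a, t, rfl, h⟩
  · rwa [h]
  · rw [h]
    intro b hb
    rcases List.mem_cons.1 hb with rfl | hb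
    · have := hl a List.mem_cons_self
      omega
    · exact hl b (List.mem_cons_of_mem _ hb)

/-- The parity correction may produce a degree below `δ` only if all samples are minimal. -/
theorem ge_of_mem_fixParity {δ : ℕ} {l : List ℕ} (hs : l.Pairwise (· ≥ ·)) (hl : ∀ b ∈ l, δ ≤ b)
    (hex : ∃ b ∈ l, δ < b) : ∀ b ∈ fixParity l, δ ≤ b := by
  rcases fixParity_eq l with h | ⟨a, t, rfl, h⟩
  · rwa [h]
  · rw [h]
    intro b hb
    rcases List.mem_cons.1 hb with rfl | hb
    · obtain ⟨b, hb, hδb⟩ := hex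
      rcases List.mem_cons.1 hb with rfl | hb
      · omega
      · have : b ≤ a := List.rel_of_pairwise_cons hs hb
        omega
    · exact hl b (List.mem_cons_of_mem _ hb)

/-- The degree sequence that is obtained from a list of samples. -/
def degreesOfSamples (l : List ℕ) : List ℕ := sortDesc (fixParity (sortDesc l))

theorem excessSum_degreesOfSamples_le (δ m : ℕ) (l : List ℕ) :
    excessSum δ m (degreesOfSamples l) ≤ excessSum δ m l + m := by
  rw [degreesOfSamples, excessSum_perm (sortDesc_perm _), ← excessSum_perm (sortDesc_perm l)]
  exact excessSum_fixParity_le _ _ _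

theorem le_excessSum_degreesOfSamples (δ m : ℕ) (l : List ℕ) :
    excessSum δ m l ≤ excessSum δ m (degreesOfSamples l) + 1 := by
  rw [degreesOfSamples, excessSum_perm (sortDesc_perm _), ← excessSum_perm (sortDesc_perm l)]
  exact le_excessSum_fixParity _ _ _

theorem countLE_degreesOfSamples_le (m : ℕ) (l : List ℕ) :
    countLE m (degreesOfSamples l) ≤ countLE m l + 1 := by
  rw [degreesOfSamples, countLE_perm (sortDesc_perm _), ← countLE_perm (sortDesc_perm l)]
  exact countLE_fixParity_le _ _

theorem le_countLE_degreesOfSamples (m : ℕ) (l : List ℕ) :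
    countLE m l ≤ countLE m (degreesOfSamples l) := by
  rw [degreesOfSamples, countLE_perm (sortDesc_perm _), ← countLE_perm (sortDesc_perm l)]
  exact le_countLE_fixParity _ _

theorem length_degreesOfSamples (l : List ℕ) : (degreesOfSamples l).length = l.length := by
  rw [degreesOfSamples, (sortDesc_perm _).length_eq, length_fixParity, (sortDesc_perm _).length_eq]

theorem le_of_mem_degreesOfSamples {M : ℕ} {l : List ℕ} (hl : ∀ b ∈ l, b ≤ M) :
    ∀ b ∈ degreesOfSamples l, b ≤ M := fun b hb =>
  le_of_mem_fixParity (fun b hb => hl b ((sortDesc_perm _).mem_iff.1 hb)) b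
    ((sortDesc_perm _).mem_iff.1 hb)

theorem ge_of_mem_degreesOfSamples {δ : ℕ} {l : List ℕ} (hl : ∀ b ∈ l, δ ≤ b)
    (hex : ∃ b ∈ l, δ < b) : ∀ b ∈ degreesOfSamples l, δ ≤ b := fun b hb =>
  ge_of_mem_fixParity (sortDesc_pairwise _) (fun b hb => hl b ((sortDesc_perm _).mem_iff.1 hb))
    (hex.imp fun _ h => ⟨(sortDesc_perm _).mem_iff.2 h.1, h.2⟩) b
    ((sortDesc_perm _).mem_iff.1 hb)

theorem excessSum_le_mul_countLE (δ m : ℕ) (l : List ℕ) :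
    excessSum δ m l ≤ m * countLE m l := by
  induction l with
  | nil => simp [excessSum_nil]
  | cons a t ih =>
    rw [excessSum_cons, countLE_cons, mul_add]
    split_ifs <;> omega

/-! ### The expected degree of one node -/

/-- The samples are typical if at least `q` of them are minimal, but not all of them. -/
def TypicalSamples (δ q : ℕ) (l : List ℕ) : Prop := q ≤ countLE δ l ∧ ∃ b ∈ l, δ < b

open Classical in
/-- The probability that `n` independent samples are not typical. -/
noncomputable def atypicalProb (p : PMF ℕ) (n δ q : ℕ) : ℝ≥0∞ :=
  pmfExp (iidList p n) fun l => if TypicalSamples δ q l then 0 else 1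

open Classical in
/-- A Chernoff bound, with the moment generating function at `-log 2`, for the number of minimal
samples, together with the probability that all samples are minimal. -/
theorem atypicalProb_le (p : PMF ℕ) (n δ q : ℕ) :
    atypicalProb p n δ q ≤
      2 ^ q * pmfExp p (fun a => if a ≤ δ then 2⁻¹ else 1) ^ n
        + pmfExp p (fun a => if a ≤ δ then 1 else 0) ^ n := by
  rw [← pmfExp_iidList_prod, ← pmfExp_iidList_prod, ← pmfExp_const_mul, ← pmfExp_add]
  refine pmfExp_mono _ fun l hl => ?_
  clear hl
  have key : (l.map fun a => if a ≤ δ then (2⁻¹ : ℝ≥0∞) else 1).prod = 2⁻¹ ^ countLE δ l := by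
    induction l with
    | nil => simp [countLE_nil]
    | cons a t ih =>
      rw [List.map_cons, List.prod_cons, ih, countLE_cons]
      split_ifs <;> simp [pow_add]
  split_ifs with h
  · exact zero_le
  · rw [TypicalSamples, not_and_or] at h
    rcases h with h | h
    · refine le_add_right ?_
      rw [key]
      obtain ⟨k, hk⟩ : ∃ k, q = countLE δ l + k := ⟨q - countLE δ l, by omega⟩
      rw [hk, pow_add, mul_right_comm, ← mul_pow, ENNReal.mul_inv_cancel (by simp) (by simp),
        one_pow, one_mul]
      exact one_le_pow₀ (by norm_num)
    · refine le_add_left ?_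
      push Not at h
      have : l.map (fun a => if a ≤ δ then (1 : ℝ≥0∞) else 0) = l.map fun _ => 1 :=
        List.map_congr_left fun a ha => by rw [if_pos (h a ha)]
      rw [this]
      simp

section node

variable {V : Type} (cap : V → ℝ) [Fintype V]

open Classical in
/-- On typical samples, the expected degree is at most `δ + K S / T` up to the effect `K m / q` of the
parity correction, where `S / T` is the average excess of the samples that are at most `m`. -/
theorem pmfExp_degree_le_of_typical (u : V) (δ m g q : ℕ) (K : ℝ) (hgq : g < q)
    (hK : (q : ℝ) ≤ K * (q - g)) (hδm : δ ≤ m) (l : List ℕ) (hlen : l.length = Fintype.card V)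
    (hmin : ∀ b ∈ l, δ ≤ b) (hm : ∀ b ∈ degreesOfSamples l, (b : ℝ) ≤ cap u ↔ b ≤ m)
    (hg : ∀ b ∈ degreesOfSamples l, (Finset.univ.filter fun v => cap v < b).card ≤ g)
    (hl : TypicalSamples δ q l) :
    pmfExp (assignDegrees cap (degreesOfSamples l) Finset.univ fun _ => 0) (fun h => (h u : ℝ≥0∞))
      ≤ δ + ENNReal.ofReal K * (excessSum δ m l * (countLE m l : ℝ≥0∞)⁻¹)
        + ENNReal.ofReal (K * m / q) := by
  have hcard : (Finset.univ : Finset V).card = (degreesOfSamples l).length := by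
    rw [length_degreesOfSamples, hlen, Finset.card_univ]
  have hgq' : (0 : ℝ) < q - g := by
    have : (g : ℝ) < q := by exact_mod_cast hgq
    linarith
  have hK0 : 0 ≤ K := by
    by_contra h
    have : (0 : ℝ) ≤ q := by positivity
    nlinarith
  have hT : q ≤ countLE m l := hl.1.trans (countLE_mono hδm l)
  have hTd := le_countLE_degreesOfSamples m l
  have key := pmfExp_assignDegrees_le cap u δ m g q K hgq hK (degreesOfSamples l) Finset.univ
    (fun _ => 0) (sortDesc_pairwise _) hcard (Finset.mem_univ u) hm hg
    (hl.1.trans (le_countLE_degreesOfSamples δ l))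
  calc _ = pmfExp (assignDegrees cap (degreesOfSamples l) Finset.univ fun _ => 0)
        (fun h => (δ : ℝ≥0∞) + ((h u - δ : ℕ) : ℝ≥0∞)) := by
        refine pmfExp_congr _ fun h hh => ?_
        have := ge_of_mem_degreesOfSamples hmin hl.2 _
          (apply_mem_of_mem_support_assignDegrees cap _ _ _ hcard h hh u (Finset.mem_univ u))
        rw [← Nat.cast_add]
        congr 1
        omega
    _ ≤ δ + ENNReal.ofReal (K * (excessSum δ m l / countLE m l) + K * m / q) := by
        rw [pmfExp_add, pmfExp_const]
        gcongr
        refine key.trans (ENNReal.ofReal_le_ofReal ?_)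
        have h1 : (excessSum δ m (degreesOfSamples l) : ℝ) ≤ excessSum δ m l + m := by
          exact_mod_cast excessSum_degreesOfSamples_le δ m l
        have hq0 : (0 : ℝ) < q := by exact_mod_cast (by omega : 0 < q)
        have h2 : (q : ℝ) ≤ countLE m l := by exact_mod_cast hT
        have h3 : (countLE m l : ℝ) ≤ countLE m (degreesOfSamples l) := by exact_mod_cast hTd
        have h4 : (0 : ℝ) < countLE m l := by linarith
        calc K * excessSum δ m (degreesOfSamples l) / countLE m (degreesOfSamples l)
            ≤ K * (excessSum δ m l + m) / countLE m l := by gcongr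
          _ = K * (excessSum δ m l / countLE m l) + K * m / countLE m l := by ring
          _ ≤ _ := by gcongr
    _ = _ := by
        rw [ENNReal.ofReal_add (by positivity) (by positivity), ENNReal.ofReal_mul hK0, ← add_assoc,
          ENNReal.ofReal_div_of_pos (by exact_mod_cast (by omega : 0 < countLE m l)),
          ENNReal.ofReal_natCast, ENNReal.ofReal_natCast, div_eq_mul_inv]

open Classical in
/-- The lower bound that matches `pmfExp_degree_le_of_typical`, solved for the average excess of the
samples. -/
theorem le_pmfExp_degree_of_typical (u : V) (δ m g q : ℕ) (κ : ℝ) (hgq : g < q) (hκ0 : 0 < κ)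
    (hκ : κ * q ≤ (q : ℝ) - g) (hδm : δ ≤ m) (l : List ℕ) (hlen : l.length = Fintype.card V)
    (hmin : ∀ b ∈ l, δ ≤ b) (hm : ∀ b ∈ degreesOfSamples l, (b : ℝ) ≤ cap u ↔ b ≤ m)
    (hg : ∀ b ∈ degreesOfSamples l, (Finset.univ.filter fun v => cap v < b).card ≤ g)
    (hl : TypicalSamples δ q l) :
    δ + excessSum δ m l * (countLE m l : ℝ≥0∞)⁻¹ ≤
      ENNReal.ofReal ((1 + 1 / q) / κ) *
        pmfExp (assignDegrees cap (degreesOfSamples l) Finset.univ fun _ => 0)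
          (fun h => (h u : ℝ≥0∞))
        + ENNReal.ofReal (1 / q) := by
  have hcard : (Finset.univ : Finset V).card = (degreesOfSamples l).length := by
    rw [length_degreesOfSamples, hlen, Finset.card_univ]
  have hgq' : (g : ℝ) < q := by exact_mod_cast hgq
  have hg0 : (0 : ℝ) ≤ g := by positivity
  have hκ1 : κ ≤ 1 := by
    by_contra h
    nlinarith
  have hT : q ≤ countLE m l := hl.1.trans (countLE_mono hδm l)
  have hTd := le_countLE_degreesOfSamples m l
  have hq0 : (0 : ℝ) < q := by exact_mod_cast (by omega : 0 < q)
  have key := le_pmfExp_assignDegrees cap u δ m g q κ hgq hκ0.le hκ (degreesOfSamples l)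
    Finset.univ (fun _ => 0) (sortDesc_pairwise _) hcard (Finset.mem_univ u) hm hg
    (hl.1.trans (le_countLE_degreesOfSamples δ l))
  have e : pmfExp (assignDegrees cap (degreesOfSamples l) Finset.univ fun _ => 0)
      (fun h => (h u : ℝ≥0∞)) = δ + pmfExp
        (assignDegrees cap (degreesOfSamples l) Finset.univ fun _ => 0)
        (fun h => ((h u - δ : ℕ) : ℝ≥0∞)) := by
    rw [← pmfExp_const (assignDegrees cap (degreesOfSamples l) Finset.univ fun _ => 0) (δ : ℝ≥0∞),
      ← pmfExp_add]
    refine pmfExp_congr _ fun h hh => ?_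
    have := ge_of_mem_degreesOfSamples hmin hl.2 _
      (apply_mem_of_mem_support_assignDegrees cap _ _ _ hcard h hh u (Finset.mem_univ u))
    rw [← Nat.cast_add]
    congr 1
    omega
  have hc1 : 1 ≤ (1 + 1 / (q : ℝ)) / κ := by
    rw [le_div_iff₀ hκ0]
    have : 0 ≤ 1 / (q : ℝ) := by positivity
    linarith
  rw [e, mul_add, add_assoc]
  gcongr
  · calc (δ : ℝ≥0∞) = ENNReal.ofReal 1 * δ := by simp
      _ ≤ _ := by gcongr
  · -- the correction adds at most one to the count and lowers the excess by at most one
    refine le_trans ?_ (add_le_add_left (mul_le_mul_right key _) _)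
    have h1 : (excessSum δ m l : ℝ) ≤ excessSum δ m (degreesOfSamples l) + 1 := by
      exact_mod_cast le_excessSum_degreesOfSamples δ m l
    have h2 : (q : ℝ) ≤ countLE m l := by exact_mod_cast hT
    have h3 : (countLE m l : ℝ) ≤ countLE m (degreesOfSamples l) := by exact_mod_cast hTd
    have h4 : (countLE m (degreesOfSamples l) : ℝ) ≤ countLE m l + 1 := by
      exact_mod_cast countLE_degreesOfSamples_le m l
    have h5 : (0 : ℝ) < countLE m l := by linarith
    have h6 : (0 : ℝ) < (countLE m (degreesOfSamples l) : ℝ) - g := by linarith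
    rw [← ENNReal.ofReal_mul (by positivity), ← ENNReal.ofReal_add (by positivity) (by positivity),
      ← div_eq_mul_inv, ← ENNReal.ofReal_natCast (excessSum δ m l),
      ← ENNReal.ofReal_natCast (countLE m l), ← ENNReal.ofReal_div_of_pos h5]
    refine ENNReal.ofReal_le_ofReal ?_
    have h7 : (countLE m (degreesOfSamples l) : ℝ) - g ≤ countLE m l * (1 + 1 / q) := by
      have : 1 ≤ (countLE m l : ℝ) * (1 / q) := by
        rw [mul_one_div, le_div_iff₀ hq0]; linarith
      linarith
    calc (excessSum δ m l : ℝ) / countLE m l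
        ≤ (excessSum δ m (degreesOfSamples l) + 1) / countLE m l := by gcongr
      _ = excessSum δ m (degreesOfSamples l) * (1 + 1 / q) / (countLE m l * (1 + 1 / q))
          + 1 / countLE m l := by
          rw [mul_div_mul_right _ _ (by positivity), add_div]
      _ ≤ excessSum δ m (degreesOfSamples l) * (1 + 1 / q)
            / ((countLE m (degreesOfSamples l) : ℝ) - g) + 1 / q := by gcongr
      _ = _ := by field_simp

open Classical in
/-- The expected degree of a node `u` that admits the degrees up to `m` is close to the mean `δ + ν`
of a sample conditioned to be at most `m`. -/
theorem pmfExp_degree_bounds (p : PMF ℕ) (n : ℕ) (hn : n = Fintype.card V) (u : V)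
    (δ m M g q : ℕ) (K κ : ℝ)
    (hp : ∀ a ∈ p.support, δ ≤ a ∧ a ≤ M) (hgq : g < q)
    (hK : (q : ℝ) ≤ K * (q - g)) (hκ0 : 0 < κ) (hκ : κ * q ≤ (q : ℝ) - g)
    (hδm : δ ≤ m) (hmM : m ≤ M)
    (hm : ∀ b ≤ M, (b : ℝ) ≤ cap u ↔ b ≤ m)
    (hg : ∀ b ≤ M, (Finset.univ.filter fun v => cap v < (b : ℝ)).card ≤ g)
    (ν : ℝ≥0∞) (hνM : ν ≤ M)
    (hν : pmfExp p (fun a => if a ≤ m then ((a - δ : ℕ) : ℝ≥0∞) else 0)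
      = ν * pmfExp p (fun a => if a ≤ m then 1 else 0)) :
    let Y := pmfExp (iidList p n) fun l =>
      pmfExp (assignDegrees cap (degreesOfSamples l) Finset.univ fun _ => 0)
        (fun h => (h u : ℝ≥0∞))
    Y ≤ δ + ENNReal.ofReal K * ν + ENNReal.ofReal (K * M / q) + M * atypicalProb p n δ q ∧
    δ + ν ≤ ENNReal.ofReal ((1 + 1 / q) / κ) * Y + ENNReal.ofReal (1 / q)
      + 3 * M * atypicalProb p n δ q := by
  intro Y
  have hgq' : (0 : ℝ) < q - g := by
    have : (g : ℝ) < q := by exact_mod_cast hgq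
    linarith
  have hK0 : 0 ≤ K := by
    by_contra h
    have : (0 : ℝ) ≤ q := by positivity
    nlinarith
  have hsupp : ∀ l ∈ (iidList p n).support, l.length = Fintype.card V ∧ (∀ b ∈ l, δ ≤ b) ∧
      ∀ b ∈ degreesOfSamples l, b ≤ M := by
    intro l hl
    obtain ⟨h1, h2⟩ := of_mem_support_iidList p n l hl
    exact ⟨h1.trans hn, fun b hb => (hp b (h2 b hb)).1,
      le_of_mem_degreesOfSamples fun b hb => (hp b (h2 b hb)).2⟩
  have hratio : ∀ l, (excessSum δ m l : ℝ≥0∞) * (countLE m l : ℝ≥0∞)⁻¹ ≤ m := by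
    intro l
    refine (mul_le_mul_left (Nat.cast_le.2 (excessSum_le_mul_countLE δ m l)) _).trans ?_
    rw [Nat.cast_mul, mul_assoc]
    exact mul_le_of_le_one_right' (ENNReal.mul_inv_le_one _)
  have hexp := pmfExp_iidList_excessSum_mul p δ m ν hν n fun k => (k : ℝ≥0∞)⁻¹
  have hmM' : (m : ℝ≥0∞) ≤ M := by exact_mod_cast hmM
  have hδM' : (δ : ℝ≥0∞) ≤ M := by exact_mod_cast hδm.trans hmM
  constructor
  · calc Y ≤ pmfExp (iidList p n) fun l =>
          (δ + ENNReal.ofReal K * (excessSum δ m l * (countLE m l : ℝ≥0∞)⁻¹)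
            + ENNReal.ofReal (K * M / q)) + M * if TypicalSamples δ q l then 0 else 1 := by
          refine pmfExp_mono _ fun l hl => ?_
          obtain ⟨h1, h2, h3⟩ := hsupp l hl
          split_ifs with ht
          · refine (pmfExp_degree_le_of_typical cap u δ m g q K hgq hK hδm l h1 h2
              (fun b hb => hm b (h3 b hb)) (fun b hb => hg b (h3 b hb)) ht).trans ?_
            rw [mul_zero, add_zero]
            gcongr
          · rw [mul_one]
            refine le_add_left (pmfExp_le_of_forall _ fun h hh => ?_)
            have := h3 _ (apply_mem_of_mem_support_assignDegrees cap _ _ _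
              (by rw [length_degreesOfSamples, h1, Finset.card_univ]) h hh u (Finset.mem_univ u))
            exact_mod_cast this
      _ ≤ _ := by
          rw [pmfExp_add, pmfExp_add, pmfExp_add, pmfExp_const, pmfExp_const, pmfExp_const_mul,
            pmfExp_const_mul, hexp, ← atypicalProb]
          gcongr
          refine mul_le_of_le_one_right' (pmfExp_le_of_forall _ fun l _ => ENNReal.mul_inv_le_one _)
  · have h1 : ν ≤ pmfExp (iidList p n) (fun l => excessSum δ m l * (countLE m l : ℝ≥0∞)⁻¹)
        + M * atypicalProb p n δ q := by
      calc ν = ν * pmfExp (iidList p n) (fun _ => 1) := by rw [pmfExp_const, mul_one]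
        _ ≤ ν * pmfExp (iidList p n) (fun l => countLE m l * (countLE m l : ℝ≥0∞)⁻¹
              + if TypicalSamples δ q l then 0 else 1) := by
            gcongr
            refine pmfExp_mono _ fun l _ => ?_
            split_ifs with ht
            · have : countLE m l ≠ 0 := by
                have := ht.1.trans (countLE_mono hδm l)
                omega
              rw [add_zero, ENNReal.mul_inv_cancel (by exact_mod_cast this) (by simp)]
            · exact le_add_left le_rfl
        _ ≤ _ := by
            rw [pmfExp_add, mul_add, hexp, ← atypicalProb]
            gcongr
    have h2 : δ + pmfExp (iidList p n) (fun l => excessSum δ m l * (countLE m l : ℝ≥0∞)⁻¹)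
        ≤ ENNReal.ofReal ((1 + 1 / q) / κ) * Y + ENNReal.ofReal (1 / q)
          + 2 * M * atypicalProb p n δ q := by
      rw [← pmfExp_const (iidList p n) (δ : ℝ≥0∞), ← pmfExp_add, ← pmfExp_const_mul,
        ← pmfExp_const (iidList p n) (ENNReal.ofReal (1 / q)), ← pmfExp_add, atypicalProb,
        ← pmfExp_const_mul, ← pmfExp_add]
      refine pmfExp_mono _ fun l hl => ?_
      obtain ⟨h1, h2, h3⟩ := hsupp l hl
      split_ifs with ht
      · rw [mul_zero, add_zero]
        exact le_pmfExp_degree_of_typical cap u δ m g q κ hgq hκ0 hκ hδm l h1 h2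
          (fun b hb => hm b (h3 b hb)) (fun b hb => hg b (h3 b hb)) ht
      · rw [mul_one, two_mul]
        exact le_add_left (add_le_add hδM' ((hratio l).trans hmM'))
    calc δ + ν ≤ δ + (pmfExp (iidList p n) (fun l => excessSum δ m l * (countLE m l : ℝ≥0∞)⁻¹)
          + M * atypicalProb p n δ q) := by gcongr
      _ ≤ (ENNReal.ofReal ((1 + 1 / q) / κ) * Y + ENNReal.ofReal (1 / q)
          + 2 * M * atypicalProb p n δ q) + M * atypicalProb p n δ q := by
          rw [← add_assoc]; gcongr
      _ = _ := by ring

end node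

/-! ### Truncated power laws: means and masses -/

/-- The mass `∫ x in k..k+1, x ^ (-γ)` that a power law gives to `k` before normalization. -/
noncomputable def powerMass (γ : ℝ) (k : ℕ) : ℝ := ∫ x in (k : ℝ)..((k : ℝ) + 1), x ^ (-γ)

/-- The mass of `{δ, …, m}` under a power law before normalization. -/
noncomputable def powerMassSum (γ : ℝ) (δ m : ℕ) : ℝ := ∑ k ∈ Finset.Icc δ m, powerMass γ k

theorem powerMass_nonneg (γ : ℝ) (k : ℕ) : 0 ≤ powerMass γ k := by
  refine intervalIntegral.integral_nonneg (by linarith) fun u hu => ?_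
  exact Real.rpow_nonneg ((Nat.cast_nonneg k).trans hu.1) _

theorem powerMass_pos (γ : ℝ) {k : ℕ} (hk : 1 ≤ k) : 0 < powerMass γ k := by
  have hk0 : (0 : ℝ) < k := by exact_mod_cast hk
  refine intervalIntegral.intervalIntegral_pos_of_pos_on
    (intervalIntegrable_rpow_neg_of_pos γ hk0 (by linarith)) (fun x hx => ?_) (by linarith)
  exact Real.rpow_pos_of_pos (hk0.trans hx.1) _

theorem powerMass_le (γ : ℝ) (hγ : 0 ≤ γ) {k : ℕ} (hk : 1 ≤ k) :
    powerMass γ k ≤ (k : ℝ) ^ (-γ) := by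
  have hk0 : (0 : ℝ) < k := by exact_mod_cast hk
  have := intervalIntegral.integral_mono_on (μ := volume) (a := (k : ℝ)) (b := (k : ℝ) + 1)
    (f := fun x : ℝ => x ^ (-γ)) (g := fun _ => (k : ℝ) ^ (-γ)) (by linarith)
    (intervalIntegrable_rpow_neg_of_pos γ hk0 (by linarith)) (by simp) (fun x hx =>
      Real.rpow_le_rpow_of_nonpos hk0 hx.1 (by linarith))
  simpa [powerMass] using this

theorem powerMassSum_pos (γ : ℝ) {δ m : ℕ} (hδ : 1 ≤ δ) (h : δ ≤ m) : 0 < powerMassSum γ δ m :=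
  Finset.sum_pos (fun _ hk => powerMass_pos γ (hδ.trans (Finset.mem_Icc.1 hk).1))
    ⟨δ, Finset.mem_Icc.2 ⟨le_rfl, h⟩⟩

theorem tplProb_eq (γ : ℝ) {δ m : ℕ} (hδ : 1 ≤ δ) (h : δ ≤ m) (k : ℕ) :
    tplProb γ δ m k = powerMass γ k / powerMassSum γ δ m := by
  have h1 := sum_tplProb γ δ m hδ h
  unfold tplProb at h1 ⊢
  rw [← Finset.sum_div] at h1
  change powerMassSum γ δ m / _ = 1 at h1
  have h2 := powerMassSum_pos γ hδ h
  rw [div_eq_one_iff_eq (fun e => by simp [e] at h1)] at h1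
  rw [h1]
  rfl

theorem pmfExp_tpl (γ : ℝ) {δ M : ℕ} (hδ : 1 ≤ δ) (h : δ ≤ M) (F : ℕ → ℝ≥0∞) :
    pmfExp (tpl γ δ M) F
      = ∑ k ∈ Finset.Icc δ M, ENNReal.ofReal (powerMass γ k / powerMassSum γ δ M) * F k := by
  rw [tpl, dif_pos ⟨hδ, h⟩, pmfExp_eq_sum _ _ (Finset.Icc δ M)]
  · refine Finset.sum_congr rfl fun k hk => ?_
    rw [PMF.ofFinset_apply, if_pos hk, tplProb_eq γ hδ h]
  · intro k hk
    rw [PMF.ofFinset_apply, if_neg hk]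

theorem pmfExp_tpl_ofReal (γ : ℝ) {δ M : ℕ} (hδ : 1 ≤ δ) (h : δ ≤ M) (F : ℕ → ℝ)
    (hF : ∀ k, 0 ≤ F k) :
    pmfExp (tpl γ δ M) (fun k => ENNReal.ofReal (F k))
      = ENNReal.ofReal ((∑ k ∈ Finset.Icc δ M, powerMass γ k * F k) / powerMassSum γ δ M) := by
  have hp := (powerMassSum_pos γ hδ h).le
  rw [pmfExp_tpl γ hδ h, Finset.sum_div, ENNReal.ofReal_sum_of_nonneg fun k _ =>
    div_nonneg (mul_nonneg (powerMass_nonneg γ k) (hF k)) hp]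
  refine Finset.sum_congr rfl fun k _ => ?_
  rw [← ENNReal.ofReal_mul (div_nonneg (powerMass_nonneg γ k) hp), div_mul_eq_mul_div]

theorem of_mem_support_tpl (γ : ℝ) {δ M : ℕ} (hδ : 1 ≤ δ) (h : δ ≤ M) {a : ℕ}
    (ha : a ∈ (tpl γ δ M).support) : δ ≤ a ∧ a ≤ M := by
  rw [tpl, dif_pos ⟨hδ, h⟩, PMF.mem_support_ofFinset_iff] at ha
  exact Finset.mem_Icc.1 ha.1

theorem tplMean_eq (γ : ℝ) {δ m : ℕ} (hδ : 1 ≤ δ) (h : δ ≤ m) :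
    tplMean γ δ m = (∑ k ∈ Finset.Icc δ m, powerMass γ k * k) / powerMassSum γ δ m := by
  rw [tplMean, integral_eq_lintegral_of_nonneg_ae (Eventually.of_forall fun k => Nat.cast_nonneg k)
    (by fun_prop), lintegral_pmf_toMeasure, pmfExp_tpl_ofReal γ hδ h _ fun k => Nat.cast_nonneg k,
    ENNReal.toReal_ofReal]
  exact div_nonneg (Finset.sum_nonneg fun k _ =>
    mul_nonneg (powerMass_nonneg γ k) (Nat.cast_nonneg k)) (powerMassSum_pos γ hδ h).le

theorem le_tplMean (γ : ℝ) {δ m : ℕ} (hδ : 1 ≤ δ) (h : δ ≤ m) : (δ : ℝ) ≤ tplMean γ δ m := by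
  rw [tplMean_eq γ hδ h, le_div_iff₀ (powerMassSum_pos γ hδ h), powerMassSum, Finset.mul_sum]
  refine Finset.sum_le_sum fun k hk => ?_
  rw [mul_comm]
  exact mul_le_mul_of_nonneg_left (by exact_mod_cast (Finset.mem_Icc.1 hk).1)
    (powerMass_nonneg γ k)

theorem tplMean_le (γ : ℝ) {δ m : ℕ} (hδ : 1 ≤ δ) (h : δ ≤ m) : tplMean γ δ m ≤ m := by
  rw [tplMean_eq γ hδ h, div_le_iff₀ (powerMassSum_pos γ hδ h), powerMassSum, Finset.mul_sum]
  refine Finset.sum_le_sum fun k hk => ?_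
  rw [mul_comm (m : ℝ)]
  exact mul_le_mul_of_nonneg_left (by exact_mod_cast (Finset.mem_Icc.1 hk).2)
    (powerMass_nonneg γ k)

/-- A truncated power law conditioned to be at most `m` is the power law truncated at `m`. -/
theorem pmfExp_tpl_excess (γ : ℝ) {δ m M : ℕ} (hδ : 1 ≤ δ) (h : δ ≤ m) (hM : m ≤ M) :
    pmfExp (tpl γ δ M) (fun a => if a ≤ m then ((a - δ : ℕ) : ℝ≥0∞) else 0)
      = ENNReal.ofReal (tplMean γ δ m - δ) * pmfExp (tpl γ δ M) (fun a => if a ≤ m then 1 else 0)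
      := by
  have hsub : (Finset.Icc δ M).filter (· ≤ m) = Finset.Icc δ m := by
    ext k
    simp only [Finset.mem_filter, Finset.mem_Icc]
    omega
  have e1 : (fun a : ℕ => if a ≤ m then ((a - δ : ℕ) : ℝ≥0∞) else 0)
      = fun a => ENNReal.ofReal (if a ≤ m then ((a - δ : ℕ) : ℝ) else 0) := by
    funext a
    split_ifs <;> simp
  have e2 : (fun a : ℕ => if a ≤ m then (1 : ℝ≥0∞) else 0)
      = fun a => ENNReal.ofReal (if a ≤ m then 1 else 0) := by
    funext a
    split_ifs <;> simp
  rw [e1, e2, pmfExp_tpl_ofReal γ hδ (h.trans hM) _ (fun k => by split_ifs <;> positivity),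
    pmfExp_tpl_ofReal γ hδ (h.trans hM) _ (fun k => by split_ifs <;> positivity),
    ← ENNReal.ofReal_mul (by linarith [le_tplMean γ hδ h]), ← mul_div_assoc]
  congr 2
  simp_rw [mul_ite, mul_zero, mul_one]
  rw [← Finset.sum_filter, ← Finset.sum_filter, hsub, sub_mul]
  change _ = _ * powerMassSum γ δ m - _ * powerMassSum γ δ m
  rw [tplMean_eq γ hδ h, div_mul_cancel₀ _ (powerMassSum_pos γ hδ h).ne', powerMassSum,
    Finset.mul_sum, ← Finset.sum_sub_distrib]
  refine Finset.sum_congr rfl fun k hk => ?_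
  rw [Nat.cast_sub (Finset.mem_Icc.1 hk).1]
  ring

theorem summable_powerMass_mul (γ : ℝ) (hγ : 2 < γ) :
    Summable fun k : ℕ => powerMass γ k * k := by
  refine Summable.of_nonneg_of_le (fun k => mul_nonneg (powerMass_nonneg γ k) (Nat.cast_nonneg k))
    (fun k => ?_) (Real.summable_nat_rpow.2 (by linarith : 1 - γ < -1))
  rcases Nat.eq_zero_or_pos k with rfl | hk
  · simp [Real.zero_rpow (by linarith : 1 - γ ≠ 0)]
  · have hk0 : (0 : ℝ) < k := by exact_mod_cast hk
    calc powerMass γ k * k ≤ (k : ℝ) ^ (-γ) * k := by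
          gcongr
          exact powerMass_le γ (by linarith) hk
      _ = (k : ℝ) ^ (1 - γ) := by
          rw [← Real.rpow_add_one hk0.ne']
          congr 1
          ring

theorem summable_indicator_powerMass (γ : ℝ) (hγ : 2 < γ) (δ : ℕ) (hδ : 1 ≤ δ) :
    Summable (Set.indicator (Set.Ici δ) (powerMass γ)) := by
  refine Summable.of_nonneg_of_le (fun k => Set.indicator_nonneg (fun k _ => powerMass_nonneg γ k) k)
    (fun k => ?_) (summable_powerMass_mul γ hγ)
  by_cases hk : k ∈ Set.Ici δ
  · rw [Set.indicator_of_mem hk]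
    have : (1 : ℝ) ≤ k := by exact_mod_cast hδ.trans hk
    nlinarith [powerMass_nonneg γ k]
  · rw [Set.indicator_of_notMem hk]
    exact mul_nonneg (powerMass_nonneg γ k) (Nat.cast_nonneg k)

theorem sum_Icc_eq_sum_range_indicator (f : ℕ → ℝ) (δ m : ℕ) :
    ∑ k ∈ Finset.Icc δ m, f k = ∑ k ∈ Finset.range (m + 1), Set.indicator (Set.Ici δ) f k := by
  classical
  simp_rw [Set.indicator_apply]
  rw [← Finset.sum_filter]
  refine Finset.sum_congr ?_ fun _ _ => rfl
  ext k
  simp only [Finset.mem_filter, Finset.mem_Icc, Finset.mem_range, Set.mem_Ici]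
  omega

theorem tendsto_sum_Icc {f : ℕ → ℝ} {δ : ℕ} (hf : Summable (Set.indicator (Set.Ici δ) f)) :
    Tendsto (fun m => ∑ k ∈ Finset.Icc δ m, f k) atTop
      (𝓝 (∑' k, Set.indicator (Set.Ici δ) f k)) := by
  simp_rw [sum_Icc_eq_sum_range_indicator]
  exact hf.hasSum.tendsto_sum_nat.comp (tendsto_add_atTop_nat 1)

theorem powerMassSum_le_tsum (γ : ℝ) (hγ : 2 < γ) (δ m : ℕ) (hδ : 1 ≤ δ) :
    powerMassSum γ δ m ≤ ∑' k, Set.indicator (Set.Ici δ) (powerMass γ) k := by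
  rw [powerMassSum, sum_Icc_eq_sum_range_indicator]
  exact (summable_indicator_powerMass γ hγ δ hδ).sum_le_tsum _
    fun k _ => Set.indicator_nonneg (fun k _ => powerMass_nonneg γ k) k

/-- Passing from `m` to `m + 1` adds mass at a point above the mean. -/
theorem tplMean_mono (γ : ℝ) {δ m M : ℕ} (hδ : 1 ≤ δ) (hm : δ ≤ m) (hM : m ≤ M) :
    tplMean γ δ m ≤ tplMean γ δ M := by
  induction M, hM using Nat.le_induction with
  | base => exact le_rfl
  | succ k hk ih =>
    refine ih.trans ?_
    have hδk := hm.trans hk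
    have h1 := tplMean_le γ hδ hδk
    have h2 := powerMassSum_pos γ hδ hδk
    have h3 := powerMassSum_pos γ hδ (hδk.trans (Nat.le_succ k))
    have e : powerMassSum γ δ (k + 1) = powerMassSum γ δ k + powerMass γ (k + 1) :=
      Finset.sum_Icc_succ_top (by omega) _
    rw [tplMean_eq γ hδ (hδk.trans (Nat.le_succ k)), le_div_iff₀ h3,
      Finset.sum_Icc_succ_top (by omega), e, mul_add]
    have e2 : tplMean γ δ k * powerMassSum γ δ k = ∑ i ∈ Finset.Icc δ k, powerMass γ i * i := by
      rw [tplMean_eq γ hδ hδk, div_mul_cancel₀ _ h2.ne']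
    rw [e2]
    have h4 := powerMass_nonneg γ (k + 1)
    push_cast
    nlinarith

/-- As the exponent is larger than `2`, the means of the truncated power laws converge. -/
theorem exists_tendsto_tplMean (γ : ℝ) (hγ : 2 < γ) (δ : ℕ) (hδ : 1 ≤ δ) :
    ∃ L : ℝ, 1 ≤ L ∧ Tendsto (tplMean γ δ) atTop (𝓝 L) := by
  have h1 := tendsto_sum_Icc ((summable_powerMass_mul γ hγ).indicator (Set.Ici δ))
  have h2 := tendsto_sum_Icc (summable_indicator_powerMass γ hγ δ hδ)
  have hpos := (powerMassSum_pos γ hδ le_rfl).trans_le (powerMassSum_le_tsum γ hγ δ δ hδ)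
  have h3 := (h1.div h2 hpos.ne').congr' (f₂ := tplMean γ δ) <| by
    filter_upwards [eventually_ge_atTop δ] with m hm
    exact (tplMean_eq γ hδ hm).symm
  refine ⟨_, ge_of_tendsto h3 ?_, h3⟩
  filter_upwards [eventually_ge_atTop δ] with m hm
  exact (by exact_mod_cast hδ : (1 : ℝ) ≤ δ).trans (le_tplMean γ hδ hm)

theorem exists_powerMass_ratio_bounds (γ : ℝ) (hγ : 2 < γ) (δ : ℕ) (hδ : 1 ≤ δ) :
    ∃ a b : ℝ, 0 < a ∧ b < 1 ∧ ∀ M, δ < M →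
      a ≤ powerMass γ δ / powerMassSum γ δ M ∧ powerMass γ δ / powerMassSum γ δ M ≤ b := by
  have hpos := (powerMassSum_pos γ hδ le_rfl).trans_le (powerMassSum_le_tsum γ hγ δ δ hδ)
  have hδ0 := powerMass_pos γ hδ
  have e : powerMassSum γ δ (δ + 1) = powerMass γ δ + powerMass γ (δ + 1) := by
    rw [powerMassSum, Finset.sum_Icc_succ_top (by omega), Finset.Icc_self, Finset.sum_singleton]
  have hδ1 := powerMass_pos γ (k := δ + 1) (by omega)
  refine ⟨powerMass γ δ / ∑' k, Set.indicator (Set.Ici δ) (powerMass γ) k,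
    powerMass γ δ / powerMassSum γ δ (δ + 1), by positivity, ?_, fun M hM => ⟨?_, ?_⟩⟩
  · rw [e, div_lt_one (by positivity)]
    linarith
  · have := powerMassSum_pos γ hδ hM.le
    gcongr
    exact powerMassSum_le_tsum γ hγ δ M hδ
  · have := powerMassSum_pos γ hδ (Nat.le_succ δ)
    gcongr
    exact Finset.sum_le_sum_of_subset_of_nonneg (Finset.Icc_subset_Icc_right hM)
      fun k _ _ => powerMass_nonneg γ k

/-- Exponential decay of the probability that the samples are not typical. -/
theorem exists_atypicalProb_tpl_le (γ : ℝ) (hγ : 2 < γ) (δ : ℕ) (hδ : 1 ≤ δ) :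
    ∃ c ρ : ℝ, 0 < c ∧ 0 ≤ ρ ∧ ρ < 1 ∧ ∀ M, δ < M → ∀ n q : ℕ, (q : ℝ) ≤ c * n →
      atypicalProb (tpl γ δ M) n δ q ≤ ENNReal.ofReal (2 * ρ ^ n) := by
  obtain ⟨a, b, ha, hb, hab⟩ := exists_powerMass_ratio_bounds γ hγ δ hδ
  have ha1 : a ≤ 1 := by
    have := hab (δ + 1) (by omega)
    linarith
  have hb0 : 0 < b := by
    have := hab (δ + 1) (by omega)
    linarith
  set r : ℝ := 1 - a / 2 with hr
  have hr0 : 0 < r := by linarith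
  have hr1 : r < 1 := by linarith
  have hl2 : 0 < Real.log 2 := Real.log_pos (by norm_num)
  have hlr : Real.log r < 0 := Real.log_neg hr0 hr1
  -- with this `c` the Chernoff bound is `2 ^ (c n) * r ^ n = (√r) ^ n`
  set c : ℝ := -Real.log r / (2 * Real.log 2) with hc
  have hc0 : 0 < c := div_pos (by linarith) (by positivity)
  have hcr : (2 : ℝ) ^ c * r = Real.sqrt r := by
    have h1 : (2 : ℝ) ^ c = Real.exp (-Real.log r / 2) := by
      rw [Real.rpow_def_of_pos (by norm_num), hc]
      congr 1
      field_simp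
    rw [h1, Real.sqrt_eq_rpow, Real.rpow_def_of_pos hr0]
    nth_rewrite 2 [← Real.exp_log hr0]
    rw [← Real.exp_add]
    congr 1
    ring
  have hsq1 : Real.sqrt r < 1 := by rw [Real.sqrt_lt' one_pos]; simpa using hr1
  refine ⟨c, max (Real.sqrt r) b, hc0, le_max_of_le_left (Real.sqrt_nonneg _), max_lt hsq1 hb,
    fun M hM n q hq => (atypicalProb_le _ n δ q).trans ?_⟩
  obtain ⟨hab1, hab2⟩ := hab M hM
  have e1 : ∀ x y : ℝ, 0 ≤ x → 0 ≤ y →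
      pmfExp (tpl γ δ M) (fun k => if k ≤ δ then ENNReal.ofReal x else ENNReal.ofReal y)
        = ENNReal.ofReal (y + (x - y) * (powerMass γ δ / powerMassSum γ δ M)) := by
    intro x y hx hy
    have : (fun k => if k ≤ δ then ENNReal.ofReal x else ENNReal.ofReal y)
        = fun k => ENNReal.ofReal (if k ≤ δ then x else y) := by
      funext k; split_ifs <;> rfl
    rw [this, pmfExp_tpl_ofReal γ hδ hM.le _ (fun k => by split_ifs <;> assumption)]
    congr 1
    have hp := powerMassSum_pos γ hδ hM.le
    have e : ∑ k ∈ Finset.Icc δ M, powerMass γ k * (if k ≤ δ then x else y)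
        = y * powerMassSum γ δ M + (x - y) * powerMass γ δ := by
      have hδM : δ ∈ Finset.Icc δ M := Finset.mem_Icc.2 ⟨le_rfl, hM.le⟩
      rw [powerMassSum, ← Finset.add_sum_erase _ _ hδM, ← Finset.add_sum_erase _ (powerMass γ) hδM,
        if_pos le_rfl]
      have : ∑ k ∈ (Finset.Icc δ M).erase δ, powerMass γ k * (if k ≤ δ then x else y)
          = y * ∑ k ∈ (Finset.Icc δ M).erase δ, powerMass γ k := by
        rw [Finset.mul_sum]
        refine Finset.sum_congr rfl fun k hk => ?_
        rw [Finset.mem_erase, Finset.mem_Icc] at hk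
        rw [if_neg (by omega), mul_comm]
      rw [this]
      ring
    rw [e]
    field_simp
  have e2 := e1 2⁻¹ 1 (by norm_num) (by norm_num)
  have e3 := e1 1 0 (by norm_num) (by norm_num)
  rw [ENNReal.ofReal_inv_of_pos (by norm_num)] at e2
  rw [ENNReal.ofReal_one, ENNReal.ofReal_zero] at e3
  simp only [ENNReal.ofReal_one, ENNReal.ofReal_ofNat] at e2
  rw [e2, e3]
  set x := powerMass γ δ / powerMassSum γ δ M
  have hx0 : 0 ≤ x := ha.le.trans hab1
  have h2 : (2 : ℝ≥0∞) ^ q = ENNReal.ofReal (2 ^ q) := by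
    rw [ENNReal.ofReal_pow (by norm_num)]; simp
  have hx1 : 0 ≤ 1 + (2⁻¹ - 1) * x := by linarith
  rw [h2, ← ENNReal.ofReal_pow hx1, ← ENNReal.ofReal_pow (by linarith),
    ← ENNReal.ofReal_mul (by positivity), ← ENNReal.ofReal_add (by positivity) (by positivity)]
  refine ENNReal.ofReal_le_ofReal ?_
  have h3 : (2 : ℝ) ^ q * (1 + (2⁻¹ - 1) * x) ^ n ≤ max (Real.sqrt r) b ^ n := by
    calc (2 : ℝ) ^ q * (1 + (2⁻¹ - 1) * x) ^ n ≤ ((2 : ℝ) ^ c) ^ n * r ^ n := by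
          gcongr
          · rw [← Real.rpow_natCast, ← Real.rpow_mul_natCast (by norm_num)]
            exact Real.rpow_le_rpow_of_exponent_le (by norm_num) hq
          · rw [hr]; linarith
      _ = Real.sqrt r ^ n := by rw [← mul_pow, hcr]
      _ ≤ _ := pow_le_pow_left₀ (Real.sqrt_nonneg _) (le_max_left _ _) _
  have h4 : (0 + (1 - 0) * x) ^ n ≤ max (Real.sqrt r) b ^ n :=
    pow_le_pow_left₀ (by linarith) (by linarith [le_max_right (Real.sqrt r) b]) _
  exact (add_le_add h3 h4).trans (two_mul _).ge

/-! ### Nodes in small communities -/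

theorem sum_mapIdx_succ (Q : ℕ → Prop) [DecidablePred Q] (l : List ℕ) :
    (l.mapIdx fun i c => if Q i then c + 1 else c).sum
      = l.sum + ∑ i ∈ Finset.range l.length, if Q i then 1 else 0 := by
  induction l generalizing Q with
  | nil => simp
  | cons a t ih =>
    rw [List.mapIdx_cons, List.sum_cons, ih fun i => Q (i + 1), List.sum_cons, List.length_cons,
      Finset.sum_range_succ']
    split_ifs <;> omega

theorem sum_enlarge {I : Finset ℕ} {l : List ℕ} (hI : I ⊆ Finset.range l.length) :
    (enlarge I l).sum = l.sum + I.card := by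
  rw [enlarge, sum_mapIdx_succ fun i => i ∈ I, ← Finset.sum_filter, Finset.sum_const, smul_eq_mul,
    mul_one, Finset.filter_mem_eq_inter, Finset.inter_eq_right.2 hI]

theorem excessSum_mapIdx_succ_le (t : ℕ) (Q : ℕ → Prop) [DecidablePred Q] (l : List ℕ)
    (hl : ∀ z ∈ l, 1 ≤ z) :
    excessSum 0 t (l.mapIdx fun i c => if Q i then c + 1 else c) ≤ 2 * excessSum 0 t l := by
  induction l generalizing Q with
  | nil => simp [excessSum_nil]
  | cons a l ih =>
    have h1 := ih (fun i => Q (i + 1)) fun z hz => hl z (List.mem_cons_of_mem _ hz)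
    have h2 := hl a List.mem_cons_self
    rw [List.mapIdx_cons, excessSum_cons, excessSum_cons]
    split_ifs <;> omega

theorem excessSum_enlarge_le (t : ℕ) (I : Finset ℕ) (l : List ℕ) (hl : ∀ z ∈ l, 1 ≤ z) :
    excessSum 0 t (enlarge I l) ≤ 2 * excessSum 0 t l :=
  excessSum_mapIdx_succ_le t (fun i => i ∈ I) l hl

theorem le_of_mem_enlarge {s : ℕ} {I : Finset ℕ} {l : List ℕ} (hl : ∀ z ∈ l, s ≤ z) :
    ∀ z ∈ enlarge I l, s ≤ z := by
  intro z hz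
  rw [enlarge, List.mem_mapIdx] at hz
  obtain ⟨i, hi, rfl⟩ := hz
  have := hl _ (List.getElem_mem hi)
  split_ifs <;> omega

theorem excessSum_append (δ m : ℕ) (l l' : List ℕ) :
    excessSum δ m (l ++ l') = excessSum δ m l + excessSum δ m l' := by
  simp [excessSum]

theorem sum_le_mul_length {B : ℕ} {l : List ℕ} (hl : ∀ z ∈ l, z ≤ B) : l.sum ≤ l.length * B := by
  simpa using List.sum_le_card_nsmul l B hl

/-- The community sizes add up to `n`: as all sizes are at most `B`, which is much smaller than `n`,
there are always enough old communities to be enlarged. -/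
theorem of_mem_support_drawSizes (p : PMF ℕ) (sel : ℕ → List ℕ → PMF (Finset ℕ))
    (hsel : IsSelectionRule sel) (s n B : ℕ) (hs : 1 ≤ s) (hB : s * B + B < n)
    (hp : ∀ a ∈ p.support, s ≤ a ∧ a ≤ B) (fuel : ℕ) :
    ∀ old : List ℕ, (∀ z ∈ old, s ≤ z ∧ z ≤ B) → old.sum < n → n ≤ old.sum + fuel →
      ∀ l ∈ (drawSizes p sel s n fuel old).support, l.sum = n ∧ ∀ z ∈ l, s ≤ z := by
  induction fuel with
  | zero => intro old _ h1 h2; omega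
  | succ fuel ih =>
    intro old hold h1 h2 l hl
    rw [drawSizes, PMF.mem_support_bind_iff] at hl
    obtain ⟨c, hc, hl⟩ := hl
    obtain ⟨hc1, hc2⟩ := hp c hc
    by_cases hlt : old.sum + c < n
    · rw [if_pos hlt] at hl
      refine ih (old ++ [c]) (fun z hz => ?_) (by simpa using hlt) ?_ l hl
      · rcases List.mem_append.1 hz with hz | hz
        · exact hold z hz
        · rw [List.mem_singleton] at hz
          subst hz
          exact ⟨hc1, hc2⟩
      · rw [List.sum_append, List.sum_singleton]
        omega
    · rw [if_neg hlt] at hl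
      dsimp only at hl
      split_ifs at hl with hk
      · rw [PMF.support_pure, Set.mem_singleton_iff] at hl
        subst hl
        refine ⟨?_, fun z hz => ?_⟩
        · rw [List.sum_append, List.sum_singleton]
          omega
        · rcases List.mem_append.1 hz with hz | hz
          · exact (hold z hz).1
          · rw [List.mem_singleton] at hz
            omega
      · rw [PMF.mem_support_map_iff] at hl
        obtain ⟨I, hI, rfl⟩ := hl
        have hlen : c - (old.sum + c - n) ≤ old.length := by
          have h3 := sum_le_mul_length fun z hz => (hold z hz).2
          by_contra hcon
          have h4 : old.length * B ≤ s * B := Nat.mul_le_mul_right _ (by omega)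
          omega
        obtain ⟨hI1, hI2⟩ := hsel _ _ hlen I hI
        exact ⟨by rw [sum_enlarge hI1, hI2]; omega, le_of_mem_enlarge fun z hz => (hold z hz).1⟩

/-- The expected number of nodes in communities of size at most `t`. While sizes are drawn, the
number of nodes that are already in such communities plus `r` times the number `n + B - ∑ z` of nodes
that may still be added is a supermartingale. The last step at most doubles the number of nodes in
small old communities and adds at most one more small community. -/
theorem pmfExp_drawSizes_le (p : PMF ℕ) (sel : ℕ → List ℕ → PMF (Finset ℕ)) (s n B t : ℕ)
    (hs : 1 ≤ s) (hp : ∀ a ∈ p.support, s ≤ a ∧ a ≤ B) (r : ℝ≥0∞)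
    (hr : pmfExp p (fun c => if c ≤ t then (c : ℝ≥0∞) else 0) ≤ r * pmfExp p (fun c => c))
    (fuel : ℕ) :
    ∀ old : List ℕ, (∀ z ∈ old, 1 ≤ z) → old.sum ≤ n →
      pmfExp (drawSizes p sel s n fuel old) (fun l => excessSum 0 t l)
        ≤ 2 * (excessSum 0 t old + r * ((n + B - old.sum : ℕ) : ℝ≥0∞)) + t := by
  induction fuel with
  | zero =>
    intro old _ _
    rw [drawSizes, pmfExp_pure, two_mul]
    exact le_add_right (le_add_right le_self_add)
  | succ fuel ih =>
    intro old hold h1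
    rw [drawSizes, pmfExp_bind]
    calc _ ≤ pmfExp p (fun c => 2 * (excessSum 0 t old + ((if c ≤ t then (c : ℝ≥0∞) else 0)
            + r * ((n + B - old.sum - c : ℕ) : ℝ≥0∞))) + t) := by
          refine pmfExp_mono _ fun c hc => ?_
          obtain ⟨hc1, hc2⟩ := hp c hc
          split_ifs with hlt hct hct
          · refine (ih (old ++ [c]) (fun z hz => ?_) ?_).trans ?_
            · rcases List.mem_append.1 hz with hz | hz
              · exact hold z hz
              · rw [List.mem_singleton] at hz; omega
            · rw [List.sum_append, List.sum_singleton]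
              omega
            · rw [excessSum_append, List.sum_append, List.sum_singleton, excessSum_cons,
                if_pos hct, excessSum_nil, Nat.cast_add, ← Nat.sub_sub, add_assoc]
              simp
          · refine (ih (old ++ [c]) (fun z hz => ?_) ?_).trans ?_
            · rcases List.mem_append.1 hz with hz | hz
              · exact hold z hz
              · rw [List.mem_singleton] at hz; omega
            · rw [List.sum_append, List.sum_singleton]
              omega
            · rw [excessSum_append, List.sum_append, List.sum_singleton, excessSum_cons,
                if_neg hct, excessSum_nil, ← Nat.sub_sub]
              simp
          all_goals
            refine le_trans (b := 2 * (excessSum 0 t old : ℝ≥0∞) + t) ?_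
              (by gcongr; exact le_self_add)
            dsimp only
            split_ifs with hk
            · rw [pmfExp_pure, excessSum_append, excessSum_cons, excessSum_nil]
              exact_mod_cast (by split_ifs <;> omega)
            · rw [pmfExp_map]
              refine pmfExp_le_of_forall _ fun I _ => ?_
              exact_mod_cast (excessSum_enlarge_le t I old hold).trans (by omega)
      _ = 2 * (excessSum 0 t old + (pmfExp p (fun c => if c ≤ t then (c : ℝ≥0∞) else 0)
            + r * pmfExp p (fun c => ((n + B - old.sum - c : ℕ) : ℝ≥0∞)))) + t := by
          rw [pmfExp_add, pmfExp_const, pmfExp_const_mul, pmfExp_add, pmfExp_const, pmfExp_add,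
            pmfExp_const_mul]
      _ ≤ 2 * (excessSum 0 t old + (r * pmfExp p (fun c => (c : ℝ≥0∞))
            + r * pmfExp p (fun c => ((n + B - old.sum - c : ℕ) : ℝ≥0∞)))) + t := by
          gcongr
      _ = _ := by
          rw [← mul_add, ← pmfExp_add, ← pmfExp_const p ((n + B - old.sum : ℕ) : ℝ≥0∞)]
          congr 4
          refine pmfExp_congr _ fun c hc => ?_
          obtain ⟨hc1, hc2⟩ := hp c hc
          exact_mod_cast (by omega)

/-! ### Size-biased truncated power laws -/

theorem powerMass_mul_bounds (β : ℝ) {k : ℕ} (hk : 1 ≤ k) :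
    powerMass β k * k ≤ ∫ x in (k : ℝ)..((k : ℝ) + 1), x ^ (1 - β) ∧
      (∫ x in (k : ℝ)..((k : ℝ) + 1), x ^ (1 - β)) ≤ 2 * (powerMass β k * k) := by
  have hk0 : (1 : ℝ) ≤ k := by exact_mod_cast hk
  have hi := intervalIntegrable_rpow_neg_of_pos β (a := k) (b := (k : ℝ) + 1)
    (by linarith) (by linarith)
  have hi' : IntervalIntegrable (fun x : ℝ => x ^ (1 - β)) volume k (k + 1) := by
    have := intervalIntegrable_rpow_neg_of_pos (β - 1) (a := k) (b := (k : ℝ) + 1)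
      (by linarith) (by linarith)
    simpa using this
  have e : ∀ x : ℝ, (k : ℝ) ≤ x → x ^ (1 - β) = x ^ (-β) * x := fun x hx => by
    rw [← Real.rpow_add_one (by linarith)]
    congr 1
    ring
  unfold powerMass
  constructor
  · rw [← intervalIntegral.integral_mul_const]
    refine intervalIntegral.integral_mono_on (by linarith) (hi.mul_const _) hi' fun x hx => ?_
    rw [e x hx.1]
    exact mul_le_mul_of_nonneg_left hx.1 (Real.rpow_nonneg (by linarith [hx.1]) _)
  · rw [← intervalIntegral.integral_mul_const, ← intervalIntegral.integral_const_mul]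
    refine intervalIntegral.integral_mono_on (by linarith) hi' ((hi.mul_const _).const_mul _)
      fun x hx => ?_
    rw [e x hx.1]
    have := Real.rpow_nonneg (by linarith [hx.1] : 0 ≤ x) (-β)
    nlinarith [hx.2]

theorem sum_integral_rpow (β : ℝ) (hβ : β < 2) {s m : ℕ} (hs : 1 ≤ s) (h : s ≤ m + 1) :
    ∑ k ∈ Finset.Icc s m, ∫ x in (k : ℝ)..((k : ℝ) + 1), x ^ (1 - β)
      = (((m : ℝ) + 1) ^ (2 - β) - (s : ℝ) ^ (2 - β)) / (2 - β) := by
  have key := intervalIntegral.sum_integral_adjacent_intervals_Ico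
    (f := fun x : ℝ => x ^ (1 - β)) (μ := volume) (a := fun k : ℕ => (k : ℝ))
    (m := s) (n := m + 1) h (by
      intro k hk
      have : (0 : ℝ) < k := by exact_mod_cast hs.trans hk.1
      have := intervalIntegrable_rpow_neg_of_pos (β - 1) (a := k) (b := ((k + 1 : ℕ) : ℝ))
        this (by push_cast; linarith)
      simpa using this)
  have hI : Finset.Icc s m = Finset.Ico s (m + 1) := by
    ext k; simp [Finset.mem_Icc, Finset.mem_Ico]
  rw [hI]
  push_cast at key
  rw [key, integral_rpow (Or.inl (by linarith))]
  ring_nf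

/-- The fraction of the nodes that a drawn community contributes if its size is at most `t`. -/
theorem pmfExp_tpl_small_le (β : ℝ) (hβ : β < 2) {s t B : ℕ} (hs : 1 ≤ s) (hst : s ≤ t)
    (hsB : s ≤ B) :
    pmfExp (tpl β s B) (fun c => if c ≤ t then (c : ℝ≥0∞) else 0)
      ≤ ENNReal.ofReal (2 * ((t : ℝ) + 1) ^ (2 - β)
          / (((B : ℝ) + 1) ^ (2 - β) - (s : ℝ) ^ (2 - β)))
        * pmfExp (tpl β s B) (fun c => c) := by
  have hs0 : (0 : ℝ) ≤ s := by positivity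
  have hD := powerMassSum_pos β hs hsB
  have e1 : (fun a : ℕ => if a ≤ t then (a : ℝ≥0∞) else 0)
      = fun a => ENNReal.ofReal (if a ≤ t then (a : ℝ) else 0) := by
    funext a
    split_ifs <;> simp
  have e2 : (fun a : ℕ => (a : ℝ≥0∞)) = fun a : ℕ => ENNReal.ofReal (a : ℝ) := by
    funext a
    simp
  have hpos : 0 < ((B : ℝ) + 1) ^ (2 - β) - (s : ℝ) ^ (2 - β) := by
    have : (s : ℝ) ≤ B := by exact_mod_cast hsB
    exact sub_pos.2 (Real.rpow_lt_rpow hs0 (by linarith) (by linarith))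
  rw [e1, e2, pmfExp_tpl_ofReal β hs hsB _ (fun k => by split_ifs <;> positivity),
    pmfExp_tpl_ofReal β hs hsB _ (fun k => by positivity),
    ← ENNReal.ofReal_mul (by positivity), ← mul_div_assoc]
  refine ENNReal.ofReal_le_ofReal (div_le_div_of_nonneg_right ?_ hD.le)
  have hnum : ∑ k ∈ Finset.Icc s B, powerMass β k * (if k ≤ t then (k : ℝ) else 0)
      ≤ ((t : ℝ) + 1) ^ (2 - β) / (2 - β) := by
    calc _ = ∑ k ∈ (Finset.Icc s B).filter (· ≤ t), powerMass β k * k := by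
          simp_rw [mul_ite, mul_zero]
          rw [← Finset.sum_filter]
      _ ≤ ∑ k ∈ Finset.Icc s t, powerMass β k * k := by
          refine Finset.sum_le_sum_of_subset_of_nonneg (fun k hk => ?_) fun k _ _ =>
            mul_nonneg (powerMass_nonneg β k) (Nat.cast_nonneg k)
          simp only [Finset.mem_filter, Finset.mem_Icc] at hk ⊢
          omega
      _ ≤ ∑ k ∈ Finset.Icc s t, ∫ x in (k : ℝ)..((k : ℝ) + 1), x ^ (1 - β) :=
          Finset.sum_le_sum fun k hk =>
            (powerMass_mul_bounds β (hs.trans (Finset.mem_Icc.1 hk).1)).1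
      _ ≤ _ := by
          rw [sum_integral_rpow β hβ hs (by omega)]
          have := Real.rpow_nonneg hs0 (2 - β)
          have h2 : 0 < 2 - β := by linarith
          gcongr
          linarith
  have hden : (((B : ℝ) + 1) ^ (2 - β) - (s : ℝ) ^ (2 - β)) / (2 - β)
      ≤ 2 * ∑ k ∈ Finset.Icc s B, powerMass β k * k := by
    rw [← sum_integral_rpow β hβ hs (by omega), Finset.mul_sum]
    exact Finset.sum_le_sum fun k hk =>
      (powerMass_mul_bounds β (hs.trans (Finset.mem_Icc.1 hk).1)).2
  refine hnum.trans ?_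
  have h2 : 0 < 2 - β := by linarith
  rw [div_le_iff₀ h2] at hden ⊢
  rw [div_mul_eq_mul_div, div_mul_eq_mul_div, le_div_iff₀ hpos]
  have := Real.rpow_nonneg (by positivity : (0 : ℝ) ≤ (t : ℝ) + 1) (2 - β)
  nlinarith

/-! ### The communities are typical -/

/-- The communities `c` have `n` nodes altogether, their sizes are at least `s`, and at most `g`
nodes are in communities of size at most `t`. -/
def TypicalSizes (s n t : ℕ) (g : ℝ) (c : List ℕ) : Prop :=
  c.sum = n ∧ (∀ z ∈ c, s ≤ z) ∧ (excessSum 0 t c : ℝ) ≤ g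

theorem tendsto_floor_rpow {a : ℝ} (ha : 0 < a) :
    Tendsto (fun n : ℕ => ⌊(n : ℝ) ^ a⌋₊) atTop atTop :=
  tendsto_nat_floor_atTop.comp ((tendsto_rpow_atTop ha).comp tendsto_natCast_atTop_atTop)

theorem tendsto_natCast_rpow_neg {a : ℝ} (ha : 0 < a) :
    Tendsto (fun n : ℕ => (n : ℝ) ^ (-a)) atTop (𝓝 0) :=
  (tendsto_rpow_neg_atTop ha).comp tendsto_natCast_atTop_atTop

theorem tendsto_floor_rpow_div {a : ℝ} (ha : a < 1) :
    Tendsto (fun n : ℕ => (⌊(n : ℝ) ^ a⌋₊ : ℝ) / n) atTop (𝓝 0) := by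
  refine squeeze_zero' (Eventually.of_forall fun n => by positivity) ?_
    (tendsto_natCast_rpow_neg (sub_pos.2 ha))
  filter_upwards [eventually_gt_atTop 0] with n hn
  have hn' : (0 : ℝ) < n := by exact_mod_cast hn
  rw [neg_sub, Real.rpow_sub hn', Real.rpow_one]
  gcongr
  exact Nat.floor_le (by positivity)

/-- The quotient of the expected sizes of a small community and of a community vanishes, as
`ζ < τ`. -/
theorem tendsto_small_ratio (P : ABCDParams) :
    Tendsto (fun n : ℕ => 2 * (((⌊(n : ℝ) ^ P.ζ⌋₊ + 1 : ℕ) : ℝ) + 1) ^ (2 - P.β)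
      / (((⌊(n : ℝ) ^ P.τ⌋₊ : ℝ) + 1) ^ (2 - P.β) - (P.s : ℝ) ^ (2 - P.β))) atTop (𝓝 0) := by
  have hβ : 0 < 2 - P.β := by linarith [P.β_lt_two]
  have hτ : 0 < P.τ := P.ζ_pos.trans P.ζ_lt_τ
  set a := 2 - P.β
  -- the upper bound `2 ((n ^ ζ + 2) / n ^ τ) ^ a / (1 - (s / n ^ τ) ^ a)`
  have h1 : Tendsto (fun n : ℕ => (n : ℝ) ^ (-(P.τ - P.ζ)) + 2 * (n : ℝ) ^ (-P.τ)) atTop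
      (𝓝 0) := by
    simpa using (tendsto_natCast_rpow_neg (sub_pos.2 P.ζ_lt_τ)).add
      ((tendsto_natCast_rpow_neg hτ).const_mul 2)
  have h2 : Tendsto (fun n : ℕ => (P.s : ℝ) * (n : ℝ) ^ (-P.τ)) atTop (𝓝 0) := by
    simpa using (tendsto_natCast_rpow_neg hτ).const_mul (P.s : ℝ)
  have h3 : Tendsto (fun n : ℕ => 2 * ((n : ℝ) ^ (-(P.τ - P.ζ)) + 2 * (n : ℝ) ^ (-P.τ)) ^ a
      / (1 - ((P.s : ℝ) * (n : ℝ) ^ (-P.τ)) ^ a)) atTop (𝓝 0) := by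
    have e1 := (h1.rpow_const (Or.inr hβ.le)).const_mul 2
    have e2 := (h2.rpow_const (Or.inr hβ.le)).const_sub 1
    rw [Real.zero_rpow hβ.ne'] at e1 e2
    have e3 := e1.div e2 (by norm_num)
    rw [mul_zero, zero_div] at e3
    exact e3
  have hlarge : ∀ᶠ n : ℕ in atTop, (P.s : ℝ) * (n : ℝ) ^ (-P.τ) < 1 :=
    h2.eventually_lt_const one_pos
  refine squeeze_zero' ?_ ?_ h3
  · filter_upwards [(tendsto_floor_rpow hτ).eventually_ge_atTop P.s] with n hn
    have : (P.s : ℝ) ≤ ⌊(n : ℝ) ^ P.τ⌋₊ := by exact_mod_cast hn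
    refine div_nonneg (by positivity) (sub_nonneg.2 ?_)
    exact Real.rpow_le_rpow (by positivity) (by linarith) hβ.le
  · filter_upwards [hlarge, eventually_gt_atTop 0] with n hn hn0
    have hn0' : (0 : ℝ) < n := by exact_mod_cast hn0
    have hy : 0 < (n : ℝ) ^ P.τ := Real.rpow_pos_of_pos hn0' _
    have hsy : (P.s : ℝ) * ((n : ℝ) ^ P.τ)⁻¹ < 1 := by
      rwa [← Real.rpow_neg hn0'.le]
    have e1 : (n : ℝ) ^ (-(P.τ - P.ζ)) + 2 * (n : ℝ) ^ (-P.τ)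
        = ((n : ℝ) ^ P.ζ + 2) * ((n : ℝ) ^ P.τ)⁻¹ := by
      rw [neg_sub, Real.rpow_sub hn0', Real.rpow_neg hn0'.le]
      ring
    have hx : 0 ≤ (n : ℝ) ^ P.ζ := by positivity
    have hpow : ((P.s : ℝ) * ((n : ℝ) ^ P.τ)⁻¹) ^ a < 1 :=
      Real.rpow_lt_one (by positivity) hsy hβ
    rw [e1, Real.rpow_neg hn0'.le]
    rw [Real.mul_rpow (by positivity) (by positivity)] at hpow ⊢
    rw [Real.mul_rpow (by positivity) (by positivity)]
    rw [Real.inv_rpow hy.le] at hpow ⊢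
    have hya : 0 < ((n : ℝ) ^ P.τ) ^ a := by positivity
    have hsya : (P.s : ℝ) ^ a < ((n : ℝ) ^ P.τ) ^ a := by
      rwa [← div_eq_mul_inv, div_lt_one hya] at hpow
    have e2 : 2 * (((n : ℝ) ^ P.ζ + 2) ^ a * (((n : ℝ) ^ P.τ) ^ a)⁻¹)
        / (1 - (P.s : ℝ) ^ a * (((n : ℝ) ^ P.τ) ^ a)⁻¹)
        = 2 * ((n : ℝ) ^ P.ζ + 2) ^ a / (((n : ℝ) ^ P.τ) ^ a - (P.s : ℝ) ^ a) := by
      have : ((n : ℝ) ^ P.τ) ^ a - (P.s : ℝ) ^ a ≠ 0 := by linarith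
      field_simp
    rw [e2]
    have hfl := Nat.floor_le hx
    have hfl2 := (Nat.lt_floor_add_one ((n : ℝ) ^ P.τ)).le
    have hfl3 : ((⌊(n : ℝ) ^ P.ζ⌋₊ + 1 : ℕ) : ℝ) + 1 ≤ (n : ℝ) ^ P.ζ + 2 := by
      push_cast
      linarith
    refine div_le_div₀ (by positivity) ?_ (sub_pos.2 hsya)
      (sub_le_sub_right (Real.rpow_le_rpow hy.le hfl2 hβ.le) _)
    exact mul_le_mul_of_nonneg_left (Real.rpow_le_rpow (by positivity) hfl3 hβ.le) (by norm_num)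

/-- With high probability only `o(n)` nodes are in communities of size at most `n ^ ζ + 1`. -/
theorem exists_tendsto_pmfExp_typicalSizes (P : ABCDParams)
    (sel : ℕ → List ℕ → PMF (Finset ℕ)) (hsel : IsSelectionRule sel) :
    ∃ ε : ℕ → ℝ, Tendsto ε atTop (𝓝 0) ∧
      Tendsto (fun n : ℕ => pmfExp (communityLaw P sel n) (Set.indicator
        {c | TypicalSizes P.s n (⌊(n : ℝ) ^ P.ζ⌋₊ + 1) (ε n * n) c} fun _ => 1)) atTop (𝓝 1) := by
  have hτ : 0 < P.τ := P.ζ_pos.trans P.ζ_lt_τ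
  have hs1 : 1 ≤ P.s := P.one_le_δ.trans P.δ_lt_s.le
  set r : ℕ → ℝ := fun n => 2 * (((⌊(n : ℝ) ^ P.ζ⌋₊ + 1 : ℕ) : ℝ) + 1) ^ (2 - P.β)
      / (((⌊(n : ℝ) ^ P.τ⌋₊ : ℝ) + 1) ^ (2 - P.β) - (P.s : ℝ) ^ (2 - P.β)) with hr
  have hr0 := tendsto_small_ratio P
  rw [← hr] at hr0
  -- `b n * n` is a bound for the expected number of nodes in small communities
  set b : ℕ → ℝ := fun n => 4 * r n + ((⌊(n : ℝ) ^ P.ζ⌋₊ + 1 : ℕ) : ℝ) / n with hb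
  have hb0 : Tendsto b atTop (𝓝 0) := by
    have h1 := (hr0.const_mul 4).add ((tendsto_floor_rpow_div (P.ζ_lt_τ.trans P.τ_lt_one)).add
      tendsto_one_div_atTop_nhds_zero_nat)
    simp only [mul_zero, add_zero] at h1
    refine h1.congr fun n => ?_
    rw [hb]
    push_cast
    ring
  have hsq : Tendsto (fun n => Real.sqrt (b n)) atTop (𝓝 0) := by
    simpa using hb0.sqrt
  refine ⟨fun n => Real.sqrt (b n), hsq, ?_⟩
  have hlow : Tendsto (fun n => 1 - ENNReal.ofReal (Real.sqrt (b n))) atTop (𝓝 1) := by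
    have := ENNReal.Tendsto.sub (tendsto_const_nhds (x := (1 : ℝ≥0∞)))
      (ENNReal.tendsto_ofReal hsq) (Or.inl ENNReal.one_ne_top)
    simpa using this
  refine tendsto_of_tendsto_of_tendsto_of_le_of_le' hlow tendsto_const_nhds ?_
    (Eventually.of_forall fun n => pmfExp_le_of_forall _ fun c _ =>
      Set.indicator_apply_le' (fun _ => le_rfl) fun _ => zero_le)
  have hB : ∀ᶠ n : ℕ in atTop, P.s * ⌊(n : ℝ) ^ P.τ⌋₊ + ⌊(n : ℝ) ^ P.τ⌋₊ < n := by
    have h1 := (tendsto_floor_rpow_div P.τ_lt_one).const_mul ((P.s : ℝ) + 1)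
    rw [mul_zero] at h1
    filter_upwards [h1.eventually_lt_const one_pos, eventually_gt_atTop 0] with n hn hn0
    have hn' : (0 : ℝ) < n := by exact_mod_cast hn0
    rw [← mul_div_assoc, div_lt_one hn'] at hn
    have : ((P.s * ⌊(n : ℝ) ^ P.τ⌋₊ + ⌊(n : ℝ) ^ P.τ⌋₊ : ℕ) : ℝ) < n := by
      push_cast
      linarith
    exact_mod_cast this
  filter_upwards [hB, (tendsto_floor_rpow hτ).eventually_ge_atTop P.s,
    (tendsto_floor_rpow P.ζ_pos).eventually_ge_atTop P.s, eventually_gt_atTop 0]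
    with n hB hsB hsM hn0
  have hn' : (0 : ℝ) < n := by exact_mod_cast hn0
  set B := ⌊(n : ℝ) ^ P.τ⌋₊ with hBdef
  set t := ⌊(n : ℝ) ^ P.ζ⌋₊ + 1 with ht
  have hp : ∀ a ∈ (tpl P.β P.s B).support, P.s ≤ a ∧ a ≤ B := fun a ha =>
    of_mem_support_tpl P.β hs1 hsB ha
  have hrn : 0 ≤ r n := by
    have : (P.s : ℝ) ≤ B := by exact_mod_cast hsB
    refine div_nonneg (by positivity) (sub_nonneg.2 ?_)
    exact Real.rpow_le_rpow (by positivity) (by linarith) (by linarith [P.β_lt_two])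
  have hbn : 0 < b n := by
    have : (0 : ℝ) < (t : ℝ) / n := by positivity
    have h2 : b n = 4 * r n + (t : ℝ) / n := rfl
    linarith
  have hsb : 0 < Real.sqrt (b n) := Real.sqrt_pos.2 hbn
  have hsupp : ∀ c ∈ (communityLaw P sel n).support, c.sum = n ∧ ∀ z ∈ c, P.s ≤ z := by
    intro c hc
    rw [communityLaw, PMF.mem_support_map_iff] at hc
    obtain ⟨l, hl, rfl⟩ := hc
    obtain ⟨h1, h2⟩ := of_mem_support_drawSizes _ sel hsel P.s n B hs1 hB hp n []
      (by simp) (by simpa using hn0) (by simp) l hl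
    exact ⟨(sortDesc_perm l).sum_eq.trans h1, fun z hz => h2 z ((sortDesc_perm l).mem_iff.1 hz)⟩
  have hexp : pmfExp (communityLaw P sel n) (fun c => excessSum 0 t c)
      ≤ ENNReal.ofReal (b n * n) := by
    rw [communityLaw, pmfExp_map]
    simp_rw [excessSum_perm (sortDesc_perm _)]
    refine (pmfExp_drawSizes_le _ sel P.s n B t hs1 hp (ENNReal.ofReal (r n))
      (pmfExp_tpl_small_le P.β P.β_lt_two hs1 (by omega) hsB) n [] (by simp) (by simp)).trans ?_
    have e : ENNReal.ofReal (b n * n)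
        = 2 * (ENNReal.ofReal (r n) * ((n + n : ℕ) : ℝ≥0∞)) + t := by
      have h2 : b n * n = 2 * (r n * ((n + n : ℕ) : ℝ)) + t := by
        have : b n = 4 * r n + (t : ℝ) / n := rfl
        rw [this]
        field_simp
        push_cast
        ring
      rw [h2, ENNReal.ofReal_add (by positivity) (by positivity), ENNReal.ofReal_mul (by norm_num),
        ENNReal.ofReal_mul hrn, ENNReal.ofReal_natCast, ENNReal.ofReal_natCast]
      simp
    rw [e, excessSum_nil, Nat.cast_zero, zero_add, List.sum_nil, Nat.sub_zero]
    gcongr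
    omega
  rw [tsub_le_iff_right]
  -- Markov's inequality
  calc (1 : ℝ≥0∞) = pmfExp (communityLaw P sel n) fun _ => 1 := (pmfExp_const _ _).symm
    _ ≤ pmfExp (communityLaw P sel n) (fun c =>
          Set.indicator {c | TypicalSizes P.s n t (Real.sqrt (b n) * n) c} (fun _ => 1) c
            + (excessSum 0 t c : ℝ≥0∞) * (ENNReal.ofReal (Real.sqrt (b n) * n))⁻¹) := by
        refine pmfExp_mono _ fun c hc => ?_
        obtain ⟨h1, h2⟩ := hsupp c hc
        by_cases h : (excessSum 0 t c : ℝ) ≤ Real.sqrt (b n) * n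
        · rw [Set.indicator_of_mem (show c ∈ {c | TypicalSizes P.s n t (Real.sqrt (b n) * n) c}
            from ⟨h1, h2, h⟩)]
          exact le_self_add
        · refine le_add_left ?_
          rw [← ENNReal.ofReal_natCast, ← div_eq_mul_inv,
            ← ENNReal.ofReal_div_of_pos (by positivity), ENNReal.one_le_ofReal,
            le_div_iff₀ (by positivity), one_mul]
          exact (not_le.1 h).le
    _ ≤ _ := by
        rw [pmfExp_add, pmfExp_mul_const]
        gcongr
        refine (mul_le_mul_left hexp _).trans ?_
        rw [← div_eq_mul_inv, ← ENNReal.ofReal_div_of_pos (by positivity)]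
        refine ENNReal.ofReal_le_ofReal (le_of_eq ?_)
        rw [mul_div_mul_right _ _ hn'.ne', Real.div_sqrt]

/-! ### Conditioning on the community sizes -/

instance : MeasurableSingletonClass ABCDOutcome := ⟨fun _ => trivial⟩

/-- The conditional expectation of the degree of the node `u`, given the community sizes `c`. -/
noncomputable def expDegree (P : ABCDParams) (n : ℕ) (c : List ℕ) (u : Node c) : ℝ≥0∞ :=
  pmfExp (degreeLaw P n) fun d =>
    pmfExp (assignDegrees (fun v : Node c => degreeCap P n c (c.get v.1)) d Finset.univ fun _ => 0)
      fun f => (f u : ℝ≥0∞)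

theorem pmfExp_abcd (P : ABCDParams) (sel : ℕ → List ℕ → PMF (Finset ℕ)) (n : ℕ)
    (F : ABCDOutcome → ℝ≥0∞) :
    pmfExp (abcd P sel n) F = pmfExp (degreeLaw P n) fun d => pmfExp (communityLaw P sel n) fun c =>
      pmfExp (assignDegrees (fun v : Node c => degreeCap P n c (c.get v.1)) d Finset.univ
        fun _ => 0) fun f => F ⟨c, f⟩ := by
  rw [abcd, pmfExp_bind]
  simp_rw [pmfExp_bind, pmfExp_map]

theorem abcd_toMeasure_sizes (P : ABCDParams) (sel : ℕ → List ℕ → PMF (Finset ℕ)) (n : ℕ)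
    (E : List ℕ → Prop) :
    (abcd P sel n).toMeasure {ω | E ω.sizes}
      = pmfExp (communityLaw P sel n) (Set.indicator {c | E c} fun _ => 1) := by
  classical
  rw [pmf_toMeasure_eq_pmfExp _ _ MeasurableSpace.measurableSet_top, pmfExp_abcd]
  have h : ∀ (c : List ℕ) (f : Node c → ℕ),
      Set.indicator {ω : ABCDOutcome | E ω.sizes} (fun _ => (1 : ℝ≥0∞)) ⟨c, f⟩
        = Set.indicator {c | E c} (fun _ => 1) c := fun _ _ => rfl
  simp_rw [h, pmfExp_const]

/-- As the degrees are independent of the communities, conditioning on the community sizes amounts to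
fixing them. -/
theorem expVol_eq (P : ABCDParams) (sel : ℕ → List ℕ → PMF (Finset ℕ)) (n : ℕ) (c : List ℕ)
    (hc : c ∈ (communityLaw P sel n).support) (j : Fin c.length) :
    expVol P sel n c j = (∑ i : Fin (c.get j), expDegree P n c ⟨j, i⟩).toReal := by
  classical
  have hsingle : ∀ G : List ℕ → ℝ≥0∞, (∀ c', c' ≠ c → G c' = 0) →
      pmfExp (communityLaw P sel n) G = communityLaw P sel n c * G c := fun G hG =>
    tsum_eq_single c fun c' hc' => by rw [hG c' hc', mul_zero]
  have hA : (abcd P sel n).toMeasure {ω | ω.sizes = c} = communityLaw P sel n c := by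
    rw [abcd_toMeasure_sizes P sel n (fun c' => c' = c), hsingle _ fun c' hc' => by simp [hc']]
    simp
  rw [expVol, integral_eq_lintegral_of_nonneg_ae (Eventually.of_forall fun _ => Nat.cast_nonneg _)
    (measurable_from_top.aestronglyMeasurable)]
  congr 1
  rw [ProbabilityTheory.cond, lintegral_smul_measure, hA,
    ← lintegral_indicator MeasurableSpace.measurableSet_top,
    lintegral_pmf_toMeasure, pmfExp_abcd]
  have h1 : ∀ d, (pmfExp (communityLaw P sel n) fun c' =>
      pmfExp (assignDegrees (fun v : Node c' => degreeCap P n c' (c'.get v.1)) d Finset.univ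
        fun _ => 0) fun f => Set.indicator {ω : ABCDOutcome | ω.sizes = c}
          (fun ω => ENNReal.ofReal (vol j ω : ℝ)) ⟨c', f⟩)
      = communityLaw P sel n c * ∑ i : Fin (c.get j),
        pmfExp (assignDegrees (fun v : Node c => degreeCap P n c (c.get v.1)) d Finset.univ
          fun _ => 0) fun f => (f ⟨j, i⟩ : ℝ≥0∞) := by
    intro d
    rw [hsingle, ← pmfExp_finset_sum]
    · congr 2
      funext f
      rw [Set.indicator_of_mem (show (⟨c, f⟩ : ABCDOutcome) ∈ {ω : ABCDOutcome | ω.sizes = c} from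
        rfl), ENNReal.ofReal_natCast, vol, dif_pos j.2]
      push_cast
      rfl
    · intro c' hc'
      simp [hc', pmfExp_const]
  simp_rw [h1]
  rw [pmfExp_const_mul, pmfExp_finset_sum, smul_eq_mul, ← mul_assoc,
    ENNReal.inv_mul_cancel ((PMF.mem_support_iff _ _).1 hc) (PMF.apply_ne_top _ _), one_mul]
  rfl

/-! ### Nodes and their degree caps -/

theorem card_node (c : List ℕ) : Fintype.card (Node c) = c.sum := by
  simp [Fintype.card_sigma]

/-- With `δ = 0`, `excessSum 0 t c` is the number of nodes in communities of size at most `t`. -/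
theorem card_filter_node_le (c : List ℕ) (t : ℕ) :
    (Finset.univ.filter fun v : Node c => c.get v.1 ≤ t).card = excessSum 0 t c := by
  have h : ∀ x : Fin c.length, (∑ _i : Fin (c.get x), if c.get x ≤ t then 1 else 0)
      = c.get x * if c.get x ≤ t then 1 else 0 := fun x => by
    rw [Finset.sum_const, Finset.card_univ, Fintype.card_fin, smul_eq_mul]
  rw [Finset.card_filter, Fintype.sum_sigma, Finset.sum_congr rfl fun x _ => h x]
  refine (Fin.sum_univ_fun_getElem c fun z => z * if z ≤ t then 1 else 0).trans ?_
  clear h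
  induction c with
  | nil => rfl
  | cons a l ih =>
    rw [List.map_cons, List.sum_cons, ih, excessSum_cons]
    split_ifs <;> simp

theorem sum_map_sq_le (c : List ℕ) :
    (c.map fun z : ℕ => (z : ℝ) ^ 2).sum ≤ (c.sum : ℝ) ^ 2 := by
  induction c with
  | nil => simp
  | cons a l ih =>
    rw [List.map_cons, List.sum_cons, List.sum_cons, Nat.cast_add, add_sq]
    have : (0 : ℝ) ≤ (a : ℝ) * (l.sum : ℝ) := by positivity
    linarith

/-- In the definition of `phi`, the sizes are cast to real numbers before the list is mapped. -/
theorem phi_eq (n : ℕ) (c : List ℕ) :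
    phi n c = 1 - (c.map fun z : ℕ => (z : ℝ) ^ 2).sum / (n : ℝ) ^ 2 := by
  rw [phi, one_div_mul_eq_div]
  congr 3
  induction c with
  | nil => rfl
  | cons a l ih => simp_all

theorem phi_le_one (n : ℕ) (c : List ℕ) : phi n c ≤ 1 := by
  have : 0 ≤ (c.map fun z : ℕ => (z : ℝ) ^ 2).sum := by
    refine List.sum_nonneg fun x hx => ?_
    obtain ⟨z, -, rfl⟩ := List.mem_map.1 hx
    positivity
  have h2 : (0 : ℝ) ≤ (c.map fun z : ℕ => (z : ℝ) ^ 2).sum / (n : ℝ) ^ 2 := by positivity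
  rw [phi_eq]
  linarith

theorem phi_nonneg (c : List ℕ) : 0 ≤ phi c.sum c := by
  have h := div_le_one_of_le₀ (sum_map_sq_le c) (by positivity)
  rw [phi_eq]
  linarith

theorem le_degreeCap (P : ABCDParams) {n : ℕ} {c : List ℕ} (hn : c.sum = n) {z : ℕ} (hz : 1 ≤ z) :
    (z : ℝ) - 1 ≤ degreeCap P n c z := by
  have h1 : (1 : ℝ) ≤ z := by exact_mod_cast hz
  have h2 : 0 ≤ P.ξ * phi n c := mul_nonneg P.ξ_pos.le (hn ▸ phi_nonneg c)
  have h3 : P.ξ * phi n c < 1 := by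
    have := mul_le_mul_of_nonneg_left (phi_le_one n c) P.ξ_pos.le
    linarith [P.ξ_lt_one]
  rw [degreeCap, le_div_iff₀ (by linarith)]
  nlinarith

theorem maxDegree_le (P : ABCDParams) (n : ℕ) (c : List ℕ) (z : ℕ) :
    maxDegree P n c z ≤ ⌊(n : ℝ) ^ P.ζ⌋₊ := Nat.floor_le_floor (min_le_right _ _)

theorem le_maxDegree (P : ABCDParams) {n : ℕ} {c : List ℕ} (hn : c.sum = n) {z : ℕ} (hz : 1 ≤ z) :
    min (z - 1) ⌊(n : ℝ) ^ P.ζ⌋₊ ≤ maxDegree P n c z := by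
  refine Nat.le_floor (le_min ?_ ?_)
  · refine le_trans ?_ (le_degreeCap P hn hz)
    have : ((min (z - 1) ⌊(n : ℝ) ^ P.ζ⌋₊ : ℕ) : ℝ) ≤ ((z - 1 : ℕ) : ℝ) :=
      Nat.cast_le.2 (min_le_left _ _)
    rwa [Nat.cast_pred hz] at this
  · refine le_trans ?_ (Nat.floor_le (by positivity : 0 ≤ (n : ℝ) ^ P.ζ))
    exact Nat.cast_le.2 (min_le_right _ _)

theorem le_degreeCap_iff_le_maxDegree (P : ABCDParams) {n : ℕ} {c : List ℕ} (hn : c.sum = n) {z : ℕ}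
    (hz : 1 ≤ z) {b : ℕ} (hb : b ≤ ⌊(n : ℝ) ^ P.ζ⌋₊) :
    (b : ℝ) ≤ degreeCap P n c z ↔ b ≤ maxDegree P n c z := by
  have hz' : (1 : ℝ) ≤ z := by exact_mod_cast hz
  have h0 : 0 ≤ degreeCap P n c z := le_trans (by linarith) (le_degreeCap P hn hz)
  have hy : 0 ≤ (n : ℝ) ^ P.ζ := by positivity
  rw [maxDegree, Nat.le_floor_iff (le_min h0 hy), le_min_iff, and_iff_left]
  exact (Nat.le_floor_iff hy).1 hb

/-! ### The expected average degree of a community -/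

/-- The bounds of `pmfExp_degree_bounds` for the nodes of a graph with typical community sizes. -/
theorem expDegree_bounds (P : ABCDParams) (n g q : ℕ) (c : List ℕ) (ρ : ℝ) (hρ : 0 ≤ ρ)
    (hδM : P.δ < ⌊(n : ℝ) ^ P.ζ⌋₊) (hgq : g < q)
    (hc : TypicalSizes P.s n (⌊(n : ℝ) ^ P.ζ⌋₊ + 1) g c)
    (hprob : atypicalProb (tpl P.γ P.δ ⌊(n : ℝ) ^ P.ζ⌋₊) n P.δ q ≤ ENNReal.ofReal ρ)
    (u : Node c) (K μ : ℝ) (hK : K = (q : ℝ) / (q - g))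
    (hμ : μ = tplMean P.γ P.δ (maxDegree P n c (c.get u.1))) :
    expDegree P n c u ≤ ENNReal.ofReal (K * μ + K * ⌊(n : ℝ) ^ P.ζ⌋₊ / q
        + ⌊(n : ℝ) ^ P.ζ⌋₊ * ρ) ∧
      ENNReal.ofReal μ ≤ ENNReal.ofReal ((1 + 1 / q) * K) * expDegree P n c u
        + ENNReal.ofReal (1 / q + 3 * ⌊(n : ℝ) ^ P.ζ⌋₊ * ρ) := by
  obtain ⟨hsum, hmin, hsmall⟩ := hc
  have hsmall' : excessSum 0 (⌊(n : ℝ) ^ P.ζ⌋₊ + 1) c ≤ g := by exact_mod_cast hsmall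
  set M := ⌊(n : ℝ) ^ P.ζ⌋₊ with hM
  have hs : ∀ v : Node c, P.δ + 1 ≤ c.get v.1 := fun v =>
    P.δ_lt_s.trans_le (hmin _ (List.get_mem _ _))
  set m := maxDegree P n c (c.get u.1) with hm
  have hmM : m ≤ M := maxDegree_le P n c _
  have hδm : P.δ ≤ m := by
    refine le_trans ?_ (le_maxDegree P hsum (z := c.get u.1) (by linarith [hs u]))
    have := hs u
    rw [le_min_iff]
    omega
  have hgq' : (0 : ℝ) < q - g := by
    have : (g : ℝ) < q := by exact_mod_cast hgq
    linarith
  have hq0 : (0 : ℝ) < q := by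
    have : (0 : ℝ) ≤ g := by positivity
    linarith
  have hK1 : 1 ≤ K := by
    rw [hK, le_div_iff₀ hgq']
    have : (0 : ℝ) ≤ g := by positivity
    linarith
  have hδμ := le_tplMean P.γ P.one_le_δ hδm
  rw [← hμ] at hδμ
  have hμM : μ - P.δ ≤ M := by
    have h1 := tplMean_le P.γ P.one_le_δ hδm
    have h2 : (m : ℝ) ≤ M := by exact_mod_cast hmM
    have h3 : (0 : ℝ) ≤ P.δ := by positivity
    rw [← hμ] at h1
    linarith
  have key := pmfExp_degree_bounds (fun v : Node c => degreeCap P n c (c.get v.1))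
    (tpl P.γ P.δ M) n (by rw [card_node, hsum]) u P.δ m M g q K (1 / K)
    (fun a ha => of_mem_support_tpl P.γ P.one_le_δ hδM.le ha) hgq
    (by rw [hK, div_mul_cancel₀ _ hgq'.ne']) (by positivity)
    (by rw [hK]; field_simp; rfl) hδm hmM
    (fun b hb => le_degreeCap_iff_le_maxDegree P hsum (by linarith [hs u]) hb)
    (fun b hb => by
      rw [← card_filter_node_le] at hsmall'
      refine (Finset.card_le_card fun v hv => ?_).trans hsmall'
      rw [Finset.mem_filter] at hv ⊢
      refine ⟨hv.1, ?_⟩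
      have h1 := (le_degreeCap P hsum (z := c.get v.1) (by linarith [hs v])).trans_lt hv.2
      have h2 : ((c.get v.1 : ℕ) : ℝ) < ((b + 1 : ℕ) : ℝ) := by push_cast; linarith
      have h3 : c.get v.1 < b + 1 := by exact_mod_cast h2
      omega)
    (ENNReal.ofReal (μ - P.δ)) (by
      rw [← ENNReal.ofReal_natCast]
      exact ENNReal.ofReal_le_ofReal hμM)
    (by rw [hμ]; exact pmfExp_tpl_excess P.γ P.one_le_δ hδm hmM)
  have hY : expDegree P n c u = pmfExp (iidList (tpl P.γ P.δ M) n) fun l =>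
      pmfExp (assignDegrees (fun v : Node c => degreeCap P n c (c.get v.1)) (degreesOfSamples l)
        Finset.univ fun _ => 0) fun h => (h u : ℝ≥0∞) := by
    rw [expDegree, degreeLaw, pmfExp_map]
    rfl
  dsimp only at key
  rw [← hY] at key
  obtain ⟨k1, k2⟩ := key
  have hδ' : (P.δ : ℝ≥0∞) = ENNReal.ofReal (P.δ : ℝ) := (ENNReal.ofReal_natCast _).symm
  have hM' : (M : ℝ≥0∞) = ENNReal.ofReal (M : ℝ) := (ENNReal.ofReal_natCast _).symm
  constructor
  · refine k1.trans ((add_le_add_right (mul_le_mul_right hprob _) _).trans ?_)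
    rw [hδ', hM', ← ENNReal.ofReal_mul (by positivity), ← ENNReal.ofReal_mul (by positivity),
      ← ENNReal.ofReal_add (by positivity) (mul_nonneg (by positivity) (by linarith)),
      ← ENNReal.ofReal_add (add_nonneg (by positivity) (mul_nonneg (by positivity) (by linarith)))
        (by positivity),
      ← ENNReal.ofReal_add (add_nonneg (add_nonneg (by positivity)
        (mul_nonneg (by positivity) (by linarith))) (by positivity)) (by positivity)]
    refine ENNReal.ofReal_le_ofReal ?_
    have : (P.δ : ℝ) ≤ K * P.δ := le_mul_of_one_le_left (by positivity) hK1
    linarith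
  · have e1 : (P.δ : ℝ≥0∞) + ENNReal.ofReal (μ - P.δ) = ENNReal.ofReal μ := by
      rw [hδ', ← ENNReal.ofReal_add (by positivity) (by linarith)]
      congr 1
      ring
    rw [e1] at k2
    refine k2.trans ?_
    rw [add_assoc, div_div_eq_mul_div, div_one,
      ENNReal.ofReal_add (by positivity) (by positivity),
      ENNReal.ofReal_mul (q := ρ) (by positivity),
      ENNReal.ofReal_mul (q := (M : ℝ)) (by positivity), ← hM', ENNReal.ofReal_ofNat]
    gcongr

/-- The relative error that follows from the two-sided bounds `Y ≤ K μ + e` and `μ ≤ K Y + e`. -/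
theorem abs_sub_le_of_bounds {Y μ K e : ℝ} (hμ : 1 ≤ μ) (hK : 1 ≤ K) (he : 0 ≤ e)
    (h1 : Y ≤ K * μ + e) (h2 : μ ≤ K * Y + e) :
    |Y - μ| ≤ ((K - 1) * (K + e) + e) * μ := by
  have he' : e ≤ e * μ := le_mul_of_one_le_right he hμ
  rw [abs_le]
  constructor
  · have : (K - 1) * Y ≤ (K - 1) * (K * μ + e * μ) := by
      exact mul_le_mul_of_nonneg_left (by linarith) (by linarith)
    nlinarith
  · have h3 : (K - 1) * 1 ≤ (K - 1) * (K + e) :=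
      mul_le_mul_of_nonneg_left (by linarith) (by linarith)
    nlinarith

/-- The relative error of the average degree of a community is explicit in terms of the bounds `g` for
the number of nodes in small communities, `q` for the number of samples equal to `δ` and `ρ` for the
probability of atypical samples. -/
theorem expAvgDegree_bound (P : ABCDParams) (sel : ℕ → List ℕ → PMF (Finset ℕ)) (n g q : ℕ)
    (c : List ℕ) (hcs : c ∈ (communityLaw P sel n).support) (ρ : ℝ) (hρ : 0 ≤ ρ)
    (hδM : P.δ < ⌊(n : ℝ) ^ P.ζ⌋₊) (hgq : g < q)
    (hc : TypicalSizes P.s n (⌊(n : ℝ) ^ P.ζ⌋₊ + 1) g c)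
    (hprob : atypicalProb (tpl P.γ P.δ ⌊(n : ℝ) ^ P.ζ⌋₊) n P.δ q ≤ ENNReal.ofReal ρ)
    (K K' e : ℝ) (hK : K = (q : ℝ) / (q - g)) (hK' : K' = (1 + 1 / q) * K)
    (he : e = K * ⌊(n : ℝ) ^ P.ζ⌋₊ / q + 1 / q + 3 * ⌊(n : ℝ) ^ P.ζ⌋₊ * ρ) (j : Fin c.length) :
    |expAvgDegree P sel n c j - tplMean P.γ P.δ (maxDegree P n c (c.get j))|
      ≤ ((K' - 1) * (K' + e) + e) * tplMean P.γ P.δ (maxDegree P n c (c.get j)) := by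
  have hs : P.δ + 1 ≤ c.get j := P.δ_lt_s.trans_le (hc.2.1 _ (List.get_mem _ _))
  have hδm : P.δ ≤ maxDegree P n c (c.get j) := by
    refine le_trans ?_ (le_maxDegree P hc.1 (z := c.get j) (by linarith))
    rw [le_min_iff]
    omega
  have hz0 : (0 : ℝ) < c.get j := by exact_mod_cast (by omega : 0 < c.get j)
  have hμ1 : (1 : ℝ) ≤ tplMean P.γ P.δ (maxDegree P n c (c.get j)) :=
    (by exact_mod_cast P.one_le_δ : (1 : ℝ) ≤ P.δ).trans (le_tplMean P.γ P.one_le_δ hδm)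
  set μ := tplMean P.γ P.δ (maxDegree P n c (c.get j)) with hμ
  set M := ⌊(n : ℝ) ^ P.ζ⌋₊
  have hgq' : (0 : ℝ) < q - g := by
    have : (g : ℝ) < q := by exact_mod_cast hgq
    linarith
  have hg0 : (0 : ℝ) ≤ g := by positivity
  have hq0 : (0 : ℝ) < q := by linarith
  have hK1 : 1 ≤ K := by
    rw [hK, le_div_iff₀ hgq']
    linarith
  have hKK' : K ≤ K' := by
    rw [hK']
    exact le_mul_of_one_le_left (by linarith) (le_add_of_nonneg_right (by positivity))
  have hb := fun i : Fin (c.get j) => expDegree_bounds P n g q c ρ hρ hδM hgq hc hprob ⟨j, i⟩ K μ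
    hK hμ
  have h1 : ∀ i : Fin (c.get j), (expDegree P n c ⟨j, i⟩).toReal ≤ K' * μ + e := fun i => by
    refine (ENNReal.toReal_le_of_le_ofReal (by positivity) (hb i).1).trans ?_
    rw [he]
    have : K * μ ≤ K' * μ := by gcongr
    have h2 : (0 : ℝ) ≤ M * ρ := by positivity
    have h3 : (0 : ℝ) ≤ 1 / q := by positivity
    linarith
  have hfin : ∀ i : Fin (c.get j), expDegree P n c ⟨j, i⟩ ≠ ∞ := fun i =>
    ne_top_of_le_ne_top ENNReal.ofReal_ne_top (hb i).1
  have h2 : ∀ i : Fin (c.get j), μ ≤ K' * (expDegree P n c ⟨j, i⟩).toReal + e := fun i => by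
    have h := (hb i).2
    rw [← ENNReal.ofReal_toReal (hfin i), ← ENNReal.ofReal_mul (by positivity),
      ← ENNReal.ofReal_add (by positivity) (by positivity),
      ENNReal.ofReal_le_ofReal_iff (by positivity), ← hK'] at h
    refine h.trans ?_
    rw [he]
    have h3 : (0 : ℝ) ≤ K * M / q := by positivity
    linarith
  have havg : expAvgDegree P sel n c j
      = (∑ i : Fin (c.get j), (expDegree P n c ⟨j, i⟩).toReal) / c.get j := by
    rw [expAvgDegree, expVol_eq P sel n c hcs, ENNReal.toReal_sum fun i _ => hfin i]
  have he0 : 0 ≤ e := by rw [he]; positivity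
  refine abs_sub_le_of_bounds hμ1 (hK1.trans hKK') he0 ?_ ?_
  · rw [havg, div_le_iff₀ hz0]
    refine (Finset.sum_le_sum fun i _ => h1 i).trans (le_of_eq ?_)
    rw [Finset.sum_const, Finset.card_univ, Fintype.card_fin, nsmul_eq_mul, mul_comm]
  · have h3 := Finset.sum_le_sum fun (i : Fin (c.get j)) (_ : i ∈ Finset.univ) => h2 i
    rw [Finset.sum_const, Finset.card_univ, Fintype.card_fin, nsmul_eq_mul,
      Finset.sum_add_distrib, ← Finset.mul_sum, Finset.sum_const, Finset.card_univ,
      Fintype.card_fin, nsmul_eq_mul] at h3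
    rw [havg, ← mul_div_assoc, ← sub_le_iff_le_add, le_div_iff₀ hz0]
    linarith

theorem tendsto_natCast_rpow_mul_pow {a ρ : ℝ} (ha : a < 1) (hρ0 : 0 ≤ ρ) (hρ : ρ < 1) :
    Tendsto (fun n : ℕ => (n : ℝ) ^ a * ρ ^ n) atTop (𝓝 0) := by
  refine squeeze_zero' (Eventually.of_forall fun n => by positivity) ?_
    (tendsto_self_mul_const_pow_of_lt_one hρ0 hρ)
  filter_upwards [eventually_ge_atTop 1] with n hn
  have hn' : (1 : ℝ) ≤ n := by exact_mod_cast hn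
  gcongr
  calc (n : ℝ) ^ a ≤ (n : ℝ) ^ (1 : ℝ) := Real.rpow_le_rpow_of_exponent_le hn' ha.le
    _ = n := Real.rpow_one _

/-- To show that an event about the community sizes holds with high probability, it suffices that it
eventually contains the possible sizes in an event `T` whose probability under `communityLaw` tends
to one. -/
theorem whp_of_eventually (P : ABCDParams) (sel : ℕ → List ℕ → PMF (Finset ℕ))
    {T E : ℕ → List ℕ → Prop}
    (hT : Tendsto (fun n => pmfExp (communityLaw P sel n) (Set.indicator {c | T n c} fun _ => 1))
      atTop (𝓝 1))
    (h : ∀ᶠ n in atTop, ∀ c ∈ (communityLaw P sel n).support, T n c → E n c) : Whp P sel E := by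
  unfold Whp
  simp_rw [abcd_toMeasure_sizes]
  refine tendsto_of_tendsto_of_tendsto_of_le_of_le' hT tendsto_const_nhds ?_
    (Eventually.of_forall fun n => pmfExp_le_of_forall _ fun c _ =>
      Set.indicator_apply_le' (fun _ => le_rfl) fun _ => zero_le)
  filter_upwards [h] with n hn
  refine pmfExp_mono _ fun c hc => ?_
  by_cases hTc : T n c
  · rw [Set.indicator_of_mem (show c ∈ {c | E n c} from hn c hc hTc)]
    exact Set.indicator_apply_le' (fun _ => le_rfl) fun _ => zero_le
  · rw [Set.indicator_of_notMem (show c ∉ {c | T n c} from hTc)]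
    exact zero_le

/-- The estimate with the truncation at `maxDegree` holds for all communities on events `T n` of high
probability on which, moreover, the community sizes have sum `n` and are at least `s`. -/
theorem exists_whp_expAvgDegree (P : ABCDParams) (sel : ℕ → List ℕ → PMF (Finset ℕ))
    (hsel : IsSelectionRule sel) :
    ∃ ε : ℕ → ℝ, Tendsto ε atTop (𝓝 0) ∧ ∃ T : ℕ → List ℕ → Prop,
      Tendsto (fun n => pmfExp (communityLaw P sel n) (Set.indicator {c | T n c} fun _ => 1))
        atTop (𝓝 1) ∧
      (∀ n c, T n c → c.sum = n ∧ ∀ z ∈ c, P.s ≤ z) ∧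
      ∀ᶠ n in atTop, ∀ c ∈ (communityLaw P sel n).support, T n c → ∀ j : Fin c.length,
        |expAvgDegree P sel n c j - tplMean P.γ P.δ (maxDegree P n c (c.get j))|
          ≤ ε n * tplMean P.γ P.δ (maxDegree P n c (c.get j)) := by
  obtain ⟨η, hη, hT⟩ := exists_tendsto_pmfExp_typicalSizes P sel hsel
  obtain ⟨a, ρ, ha, hρ0, hρ1, hprob⟩ := exists_atypicalProb_tpl_le P.γ P.two_lt_γ P.δ P.one_le_δ
  have hζ1 : P.ζ < 1 := P.ζ_lt_τ.trans P.τ_lt_one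
  -- `g n` bounds the number of nodes that refuse some degree, and at least `q n` samples equal `δ`
  -- except with probability `2 ρ ^ n`
  set g : ℕ → ℕ := fun n => ⌊η n * n⌋₊ with hg
  set q : ℕ → ℕ := fun n => ⌊a * n⌋₊ with hq
  set K : ℕ → ℝ := fun n => (q n : ℝ) / (q n - g n) with hK
  set K' : ℕ → ℝ := fun n => (1 + 1 / q n) * K n with hK'
  set e : ℕ → ℝ := fun n => K n * ⌊(n : ℝ) ^ P.ζ⌋₊ / q n + 1 / q n
    + 3 * ⌊(n : ℝ) ^ P.ζ⌋₊ * (2 * ρ ^ n) with he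
  have hqn : Tendsto (fun n : ℕ => (q n : ℝ) / n) atTop (𝓝 a) :=
    (tendsto_nat_floor_mul_div_atTop ha.le).comp tendsto_natCast_atTop_atTop
  have hqtop : Tendsto (fun n => (q n : ℝ)) atTop atTop :=
    tendsto_natCast_atTop_atTop.comp
      (tendsto_nat_floor_atTop.comp (tendsto_natCast_atTop_atTop.const_mul_atTop ha))
  have hqinv : Tendsto (fun n => 1 / (q n : ℝ)) atTop (𝓝 0) := by
    simp_rw [one_div]
    exact hqtop.inv_tendsto_atTop
  have hgn : Tendsto (fun n : ℕ => (g n : ℝ) / n) atTop (𝓝 0) := by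
    have hη' : Tendsto (fun n => |η n|) atTop (𝓝 0) := by simpa using hη.abs
    refine squeeze_zero' (Eventually.of_forall fun n => by positivity) ?_ hη'
    filter_upwards [eventually_gt_atTop 0] with n hn
    have hn' : (0 : ℝ) < n := by exact_mod_cast hn
    rw [div_le_iff₀ hn']
    calc (g n : ℝ) ≤ (⌊|η n| * n⌋₊ : ℝ) := by
          refine Nat.cast_le.2 (Nat.floor_le_floor ?_)
          gcongr
          exact le_abs_self _
      _ ≤ _ := Nat.floor_le (by positivity)
  have hK1 : Tendsto K atTop (𝓝 1) := by
    have h1 := hqn.div (hqn.sub hgn) (by simpa using ha.ne')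
    rw [sub_zero, div_self ha.ne'] at h1
    refine h1.congr' ?_
    filter_upwards [eventually_gt_atTop 0] with n hn
    have hn' : (n : ℝ) ≠ 0 := by exact_mod_cast hn.ne'
    simp only [hK, Pi.div_apply]
    rw [← sub_div, div_div_div_cancel_right₀ hn']
  have hK'1 : Tendsto K' atTop (𝓝 1) := by
    have h1 := (hqinv.const_add 1).mul hK1
    rwa [add_zero, one_mul] at h1
  have hMq : Tendsto (fun n : ℕ => (⌊(n : ℝ) ^ P.ζ⌋₊ : ℝ) / q n) atTop (𝓝 0) := by
    have h1 := (tendsto_floor_rpow_div hζ1).div hqn ha.ne'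
    rw [zero_div] at h1
    refine h1.congr' ?_
    filter_upwards [eventually_gt_atTop 0] with n hn
    have hn' : (n : ℝ) ≠ 0 := by exact_mod_cast hn.ne'
    simp only [Pi.div_apply]
    rw [div_div_div_cancel_right₀ hn']
  have hMρ : Tendsto (fun n : ℕ => (⌊(n : ℝ) ^ P.ζ⌋₊ : ℝ) * ρ ^ n) atTop (𝓝 0) := by
    refine squeeze_zero (fun n => by positivity) (fun n => ?_)
      (tendsto_natCast_rpow_mul_pow hζ1 hρ0 hρ1)
    gcongr
    exact Nat.floor_le (by positivity)
  have he0 : Tendsto e atTop (𝓝 0) := by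
    have h1 := ((hK1.mul hMq).add hqinv).add (hMρ.const_mul 6)
    simp only [mul_zero, add_zero] at h1
    refine h1.congr fun n => ?_
    rw [he]
    ring
  refine ⟨fun n => (K' n - 1) * (K' n + e n) + e n, ?_,
    fun n c => TypicalSizes P.s n (⌊(n : ℝ) ^ P.ζ⌋₊ + 1) (η n * n) c, hT,
    fun n c hc => ⟨hc.1, hc.2.1⟩, ?_⟩
  · have h1 := ((hK'1.sub_const 1).mul (hK'1.add he0)).add he0
    simpa using h1
  · have hgq : ∀ᶠ n in atTop, g n < q n := by
      filter_upwards [hgn.eventually_lt_const (half_pos ha),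
        hqn.eventually_const_lt (half_lt_self ha), eventually_gt_atTop 0] with n h1 h2 hn
      have hn' : (0 : ℝ) < n := by exact_mod_cast hn
      have := (div_lt_div_iff_of_pos_right hn').1 (h1.trans h2)
      exact_mod_cast this
    filter_upwards [hgq, (tendsto_floor_rpow P.ζ_pos).eventually_gt_atTop P.δ] with n hgq hδM
    intro c hcs hc j
    refine expAvgDegree_bound P sel n (g n) (q n) c hcs (2 * ρ ^ n) (by positivity) hδM hgq ?_ ?_
      (K n) (K' n) (e n) rfl rfl rfl j
    · refine ⟨hc.1, hc.2.1, ?_⟩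
      have : 0 ≤ η n * n := le_trans (by positivity) hc.2.2
      exact_mod_cast (Nat.le_floor hc.2.2 : _ ≤ g n)
    · exact hprob _ hδM n (q n) (Nat.floor_le (by positivity))

theorem mainTheorem2 (P : ABCDParams) (sel : ℕ → List ℕ → PMF (Finset ℕ))
    (hsel : IsSelectionRule sel) :
    (∃ ε : ℕ → ℝ, Tendsto ε atTop (𝓝 0) ∧
      Whp P sel fun n c => ∀ j : Fin c.length,
        |expAvgDegree P sel n c j - tplMean P.γ P.δ (maxDegree P n c (c.get j))|
          ≤ ε n * tplMean P.γ P.δ (maxDegree P n c (c.get j))) ∧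
    (∀ z : ℕ → ℕ, Tendsto z atTop atTop →
      ∃ ε : ℕ → ℝ, Tendsto ε atTop (𝓝 0) ∧
        Whp P sel fun n c => ∀ j : Fin c.length, z n ≤ c.get j →
          |expAvgDegree P sel n c j - tplMean P.γ P.δ ⌊(n : ℝ) ^ P.ζ⌋₊|
            ≤ ε n * tplMean P.γ P.δ ⌊(n : ℝ) ^ P.ζ⌋₊) ∧
    (∃ a b : ℝ, 0 < a ∧ 0 < b ∧
      Whp P sel fun n c => ∀ j : Fin c.length,
        a * tplMean P.γ P.δ ⌊(n : ℝ) ^ P.ζ⌋₊ ≤ expAvgDegree P sel n c j ∧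
          expAvgDegree P sel n c j ≤ b * tplMean P.γ P.δ ⌊(n : ℝ) ^ P.ζ⌋₊) := by
  obtain ⟨ε, hε, T, hT, hTs, hbound⟩ := exists_whp_expAvgDegree P sel hsel
  obtain ⟨L, hL1, hL⟩ := exists_tendsto_tplMean P.γ P.two_lt_γ P.δ P.one_le_δ
  have hδ1 : (1 : ℝ) ≤ P.δ := by exact_mod_cast P.one_le_δ
  have hMtop := tendsto_floor_rpow P.ζ_pos
  have hδm : ∀ᶠ n : ℕ in atTop, ∀ c, T n c → ∀ j : Fin c.length,
      P.δ ≤ maxDegree P n c (c.get j) := by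
    filter_upwards [hMtop.eventually_ge_atTop P.δ] with n hn c hc j
    have hs : P.δ + 1 ≤ c.get j := P.δ_lt_s.trans_le ((hTs n c hc).2 _ (List.get_mem _ _))
    refine le_trans ?_ (le_maxDegree P (hTs n c hc).1 (z := c.get j) (by linarith))
    rw [le_min_iff]
    omega
  refine ⟨⟨ε, hε, whp_of_eventually P sel hT hbound⟩, fun z hz => ?_, ?_⟩
  · -- the truncation of a community of size at least `z n` is at least `k n`
    set k : ℕ → ℕ := fun n => min (z n - 1) ⌊(n : ℝ) ^ P.ζ⌋₊ with hk
    have hktop : Tendsto k atTop atTop :=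
      tendsto_inf_atTop _ ((tendsto_sub_atTop_nat 1).comp hz) hMtop
    have hdiff : Tendsto (fun n : ℕ => tplMean P.γ P.δ ⌊(n : ℝ) ^ P.ζ⌋₊ - tplMean P.γ P.δ (k n))
        atTop (𝓝 0) := by
      simpa using (hL.comp hMtop).sub (hL.comp hktop)
    refine ⟨fun n => |ε n| + (tplMean P.γ P.δ ⌊(n : ℝ) ^ P.ζ⌋₊ - tplMean P.γ P.δ (k n)),
      by simpa using hε.abs.add hdiff, whp_of_eventually P sel hT ?_⟩
    filter_upwards [hbound, hδm, hktop.eventually_ge_atTop P.δ] with n h1 h2 h3 c hcs hc j hj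
    have hs : 1 ≤ c.get j := by
      have := P.δ_lt_s.trans_le ((hTs n c hc).2 _ (List.get_mem _ j))
      omega
    have h4 := h1 c hcs hc j
    have h5 := maxDegree_le P n c (c.get j)
    have h6 : k n ≤ maxDegree P n c (c.get j) :=
      (min_le_min_right _ (Nat.sub_le_sub_right hj 1)).trans (le_maxDegree P (hTs n c hc).1 hs)
    have h7 := tplMean_mono P.γ P.one_le_δ (h2 c hc j) h5
    have h8 := tplMean_mono P.γ P.one_le_δ h3 h6
    have h9 := le_tplMean P.γ P.one_le_δ ((h2 c hc j).trans h5)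
    have h0 := le_tplMean P.γ P.one_le_δ (h2 c hc j)
    set μ := tplMean P.γ P.δ (maxDegree P n c (c.get j))
    set μM := tplMean P.γ P.δ ⌊(n : ℝ) ^ P.ζ⌋₊
    set μk := tplMean P.γ P.δ (k n)
    have e1 : ε n * μ ≤ |ε n| * μM :=
      mul_le_mul (le_abs_self _) h7 (by linarith) (abs_nonneg _)
    have e2 : μM - μk ≤ (μM - μk) * μM := le_mul_of_one_le_right (by linarith) (by linarith)
    rw [abs_le] at h4 ⊢
    constructor <;> linarith
  · refine ⟨1 / (2 * L), 2, by positivity, by norm_num, whp_of_eventually P sel hT ?_⟩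
    filter_upwards [hbound, hδm, hε.eventually_lt_const (by norm_num : (0 : ℝ) < 1 / 2)]
      with n h1 h2 h3 c hcs hc j
    have h4 := h1 c hcs hc j
    have h5 := maxDegree_le P n c (c.get j)
    have h7 := tplMean_mono P.γ P.one_le_δ (h2 c hc j) h5
    have h0 := le_tplMean P.γ P.one_le_δ (h2 c hc j)
    have hML : tplMean P.γ P.δ ⌊(n : ℝ) ^ P.ζ⌋₊ ≤ L := by
      refine ge_of_tendsto hL ?_
      filter_upwards [eventually_ge_atTop ⌊(n : ℝ) ^ P.ζ⌋₊] with m hm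
      exact tplMean_mono P.γ P.one_le_δ ((h2 c hc j).trans h5) hm
    set μ := tplMean P.γ P.δ (maxDegree P n c (c.get j))
    set μM := tplMean P.γ P.δ ⌊(n : ℝ) ^ P.ζ⌋₊
    have e1 : ε n * μ ≤ 1 / 2 * μ := mul_le_mul_of_nonneg_right h3.le (by linarith)
    have e2 : 1 / (2 * L) * μM ≤ 1 / 2 := by
      rw [one_div_mul_eq_div, div_le_iff₀ (by positivity)]
      linarith
    rw [abs_le] at h4
    constructor <;> linarith
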